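/- For each $d\in\mathbb N$ let $\phi_d$ be a probability measure on $\mathbb R^d$ that is even and assigns measure zero to each hyperplane through the origin. For $N>d$ let $X_1,\dots,X_N$ be independent random vectors with distribution $\phi_d$. The Cover--Efron cone $C_N$ is the random cone $\operatorname{pos}\{X_1,\dots,X_N\}$ under the condition that this positive hull is different from $\mathbb R^d$. Let $f_k(C)$ be the number of $k$-dimensional faces of a polyhedral cone $C$, so that $$\mathbb E f_k(C_N)=\mathbb E\big[f_k(\operatorname{pos}\{X_1,\dots,X_N\})\,\big|\,\operatorname{pos}\{X_1,\dots,X_N\}\neq\mathbb R^d\big].$$ Put $\mathsf H(x)=-x\log x-(1-x)\log(1-x)$ and $G(\delta,\rho)=\mathsf H(\delta)+\delta\,\mathsf H(\rho)-(1-\rho\delta)\log 2$ for $\delta,\rho\in[0,1]$. For $1/2<\delta<1$ let $\rho_S(\delta)$ be the unique zero of $G(\delta,\cdot)$ in $[0,1]$, and put $\rho_W(\delta)=\max\{0,2-1/\delta\}$. **Theorem.** Let $1/2<\delta<1$ and $0<\rho<\rho_W(\delta)=2-1/\delta$ be given. Let $d_0\in\mathbb N$ and let $N=N(d)$, $k=k(d)$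 be integers with $1\le k<d<N$ for all $d\ge d_0$ such that $$\delta_d:=\frac dN\to\delta,\qquad \rho_d:=\frac kd\to\rho\qquad\text{as } d\to\infty .$$ Then there are a function $h$ and constants $0<a\le b<\infty$ such that, for all $d\ge d_0$, one has $h(d)\in[a,b]$ and $$\binom Nk-\mathbb E f_k(C_N)=\frac1N\,e^{N G(\delta_d,\rho_d)}\,h(d).$$ In particular, $$\lim_{d\to\infty}\left[\binom Nk-\mathbb E f_k(C_N)\right]=\begin{cases}0&\text{if }\rho<\rho_S(\delta),\\ \infty&\text{if }\rho>\rho_S(\delta).\end{cases}$$ If $\rho=\rho_S(\delta)$, then $N=N(d)$ and $k=k(d)$ can be chosen, with $1\le k<d<N$ for all $d\ge 2$, $d/N\to\delta$ and $k/d\to\rho$, such that $$\liminf_{d\to\infty}\left[\binom Nk-\mathbb E f_k(C_N)\right]=0\quad\text{and}\quad\limsup_{d\to\infty}\left[\binom Nk-\mathbb E f_k(C_N)\right]=\infty .$$ -/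

import Mathlib

open MeasureTheory ProbabilityTheory Filter Topology

noncomputable section

namespace CoverEfron

/-- The positive hull `pos {x₁, …, x_N}` of finitely many vectors of `ℝ^d`. -/
def pos {d N : ℕ} (x : Fin N → EuclideanSpace ℝ (Fin d)) :
    PointedCone ℝ (EuclideanSpace ℝ (Fin d)) :=
  PointedCone.hull ℝ (Set.range x)

/-- The number `f_k(C)` of `k`-dimensional faces of a convex cone `C` in `ℝ^d`; the dimension of a
face is the dimension of its linear hull. -/
def numFaces {d : ℕ} (k : ℕ) (C : PointedCone ℝ (EuclideanSpace ℝ (Fin d))) : ℕ :=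
  {F : PointedCone ℝ (EuclideanSpace ℝ (Fin d)) | F.IsFaceOf C ∧
    Module.finrank ℝ (Submodule.span ℝ (F : Set (EuclideanSpace ℝ (Fin d)))) = k}.ncard

/-- The measures that are admitted as distributions of the random vectors: probability measures
on `ℝ^d` that are even and give measure zero to each hyperplane through the origin. -/
structure Admissible {d : ℕ} (φ : Measure (EuclideanSpace ℝ (Fin d))) : Prop where
  isProbabilityMeasure : IsProbabilityMeasure φ
  even : φ.map (fun x => -x) = φ
  hyperplane : ∀ u : EuclideanSpace ℝ (Fin d), u ≠ 0 → φ {x | inner ℝ u x = 0} = 0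

/-- `E f_k(C_N)`, where the Cover–Efron cone `C_N` is the positive hull of `N` independent random
vectors with distribution `φ`, under the condition that this positive hull is different from
`ℝ^d`: the joint law of the vectors is the `N`-fold product of `φ`, and the expectation is taken
with respect to its conditional probability measure. -/
def expectedFaces {d : ℕ} (φ : Measure (EuclideanSpace ℝ (Fin d))) (N k : ℕ) : ℝ :=
  ∫ x, (numFaces k (pos x) : ℝ)
    ∂(ProbabilityTheory.cond (Measure.pi fun _ : Fin N => φ) {x | pos x ≠ ⊤})

/-- The difference `binom(N, k) - E f_k(C_N)`. -/
def faceDeficit {d : ℕ} (φ : Measure (EuclideanSpace ℝ (Fin d))) (N k : ℕ) : ℝ :=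
  (N.choose k : ℝ) - expectedFaces φ N k

/-- `G(δ, ρ) = H(δ) + δ H(ρ) - (1 - ρ δ) log 2`, with the binary entropy function `H` to base
`e`. -/
def G (δ ρ : ℝ) : ℝ :=
  Real.binEntropy δ + δ * Real.binEntropy ρ - (1 - ρ * δ) * Real.log 2

/-- `ρ_W(δ) = max {0, 2 - 1/δ}`. -/
def rhoW (δ : ℝ) : ℝ := max 0 (2 - δ⁻¹)

/-- `ρ_S(δ)`: for `1/2 < δ < 1`, the unique zero of `G(δ, ·)` in `[0, 1]`
(see `eq_rhoS_iff`). -/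
def rhoS (δ : ℝ) : ℝ := sInf {x | x ∈ Set.Icc (0 : ℝ) 1 ∧ G δ x = 0}

theorem existsUnique_zero {δ : ℝ} (h₁ : 1 / 2 < δ) (h₂ : δ < 1) :
    ∃! x, x ∈ Set.Icc (0 : ℝ) 1 ∧ G δ x = 0 := by
  have hl : 0 < Real.log 2 := Real.log_pos (by norm_num)
  have hc := Real.strictConcave_binEntropy
  have h0 : G δ 0 < 0 := by
    have : Real.binEntropy δ < Real.log 2 :=
      Real.binEntropy_lt_log_two.2 (by intro h; norm_num [h] at h₁)
    simp only [G, Real.binEntropy_zero]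
    linarith
  have h1 : 0 < G δ 1 := by
    have := hc.concaveOn.2 (show (2⁻¹ : ℝ) ∈ Set.Icc (0 : ℝ) 1 by norm_num)
      (show (1 : ℝ) ∈ Set.Icc (0 : ℝ) 1 by norm_num)
      (show 0 ≤ 2 * (1 - δ) by linarith) (show 0 ≤ 2 * δ - 1 by linarith) (by ring)
    simp only [smul_eq_mul, Real.binEntropy_two_inv, Real.binEntropy_one] at this
    rw [show 2 * (1 - δ) * 2⁻¹ + (2 * δ - 1) * 1 = δ by ring] at this
    simp only [G, Real.binEntropy_one]
    nlinarith [mul_pos (sub_pos.2 h₂) hl]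
  have key : ∀ x y, 0 ≤ x → x < y → y ≤ 1 → G δ x = 0 → G δ y = 0 → False := by
    intro x y hx hxy hy gx gy
    have hy1 : y < 1 := lt_of_le_of_ne hy (by rintro rfl; linarith)
    have hD : 0 < 1 - x := by linarith
    have hs := hc.concaveOn.2 (show x ∈ Set.Icc (0 : ℝ) 1 from ⟨hx, by linarith⟩)
      (show (1 : ℝ) ∈ Set.Icc (0 : ℝ) 1 by norm_num)
      (show 0 ≤ (1 - y) / (1 - x) from div_nonneg (by linarith) hD.le)
      (show 0 ≤ (y - x) / (1 - x) from div_nonneg (by linarith) hD.le)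
      (by field_simp; ring)
    simp only [smul_eq_mul, Real.binEntropy_one] at hs
    have e : (1 - y) / (1 - x) * x + (y - x) / (1 - x) * 1 = y := by field_simp; ring
    rw [e] at hs
    have ha : 0 < (y - x) / (1 - x) := div_pos (by linarith) hD
    have e2 : (1 - y) / (1 - x) = 1 - (y - x) / (1 - x) := by field_simp; ring
    have e3 : y = x + (y - x) / (1 - x) * (1 - x) := by field_simp; ring
    set b := (y - x) / (1 - x) with hb
    have hG : (1 - b) * G δ x + b * G δ 1 ≤ G δ y := by
      simp only [G, Real.binEntropy_one]
      rw [e2] at hs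
      have := mul_le_mul_of_nonneg_left hs (by linarith : (0 : ℝ) ≤ δ)
      have e4 : y * δ * Real.log 2 = (x + b * (1 - x)) * δ * Real.log 2 := by rw [← e3]
      nlinarith
    rw [gx, gy] at hG
    nlinarith [mul_pos ha h1]
  have hcont : ContinuousOn (G δ) (Set.Icc 0 1) := by
    unfold G
    fun_prop
  obtain ⟨x, hx, gx⟩ := intermediate_value_Icc (zero_le_one) hcont ⟨h0.le, h1.le⟩
  refine ⟨x, ⟨hx, gx⟩, ?_⟩
  rintro y ⟨hy, gy⟩
  rcases lt_trichotomy x y with h | h | h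
  · exact (key x y hx.1 h hy.2 gx gy).elim
  · exact h.symm
  · exact (key y x hy.1 h hx.2 gy gx).elim

theorem eq_rhoS_iff {δ : ℝ} (h₁ : 1 / 2 < δ) (h₂ : δ < 1) (x : ℝ) :
    x = rhoS δ ↔ x ∈ Set.Icc (0 : ℝ) 1 ∧ G δ x = 0 := by
  obtain ⟨z, hz, hu⟩ := existsUnique_zero h₁ h₂
  have hS : {x | x ∈ Set.Icc (0 : ℝ) 1 ∧ G δ x = 0} = {z} := by
    ext y
    exact ⟨fun hy => hu y hy, fun hy => by rw [Set.mem_singleton_iff.1 hy]; exact hz⟩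
  rw [rhoS, hS, csInf_singleton]
  exact ⟨fun h => h ▸ hz, hu x⟩

end CoverEfron

end

/-! Write C for `coverNum`. In general position the k-faces of the positive hull with k < d
correspond to the k-sets I for which some u is orthogonal to the vectors indexed by I and positive
on all others. The law of the vectors is invariant under sign changes, so the probability of this
event is the fraction of sign vectors realizing it, and that fraction is the same for every
configuration in general position: 2^k C(N-k, d-k) / 2^N (`GeneralPosition.numSigns_compl`). The
conditioning event has probability C(N, d) / 2^N, by the same count with I empty. Hence the deficit
is binom(N, k) (C(N, d) - 2^k C(N-k, d-k)) / C(N, d).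

The identity C(n+2, m+1) = 2 C(n+1, m) + 2 binom(n, m) telescopes the bracket into the sum over j <
k of 2^(k-j) binom(N-k-1+j, d-k+j). Ratios of consecutive terms are bounded through (N-k) /
(2(d-k)), whose limit is below 1 exactly when ρ < 2 - 1/δ; the sum is then comparable to its first
term. Since δ > 1/2, C(N, d) is eventually at least 2^(N-1). So the deficit has the order of
`leadingTerm`, and Stirling's formula turns this into e^(NG) / N.

The sign of G decides the limit off ρ_S. At ρ_S, k is shifted slightly up and down along a sparse
subsequence, slowly enough that both limiting behaviours survive. -/

namespace CoverEfron

/-! ### Counting sign vectors in general position. -/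

/-- `coverNum n m` is the number of sign vectors that a linear subspace of dimension `m` in general
position in `ℝ^n` meets. -/
def coverNum : ℕ → ℕ → ℕ
  | 0, _ => 1
  | _ + 1, 0 => 0
  | n + 1, m + 1 => coverNum n (m + 1) + coverNum n m

/-- Any at most `d` of the vectors are linearly independent. -/
def GeneralPosition {d N : ℕ} (x : Fin N → EuclideanSpace ℝ (Fin d)) : Prop :=
  ∀ I : Finset (Fin N), I.card ≤ d → LinearIndepOn ℝ x (I : Set (Fin N))

/-- Some vector is orthogonal to the `x i` with `i ∈ I` and has positive inner product with the
`x j` with `j ∈ J`. -/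
def Separable {d N : ℕ} (I J : Finset (Fin N)) (x : Fin N → EuclideanSpace ℝ (Fin d)) : Prop :=
  ∃ u : EuclideanSpace ℝ (Fin d), (∀ i ∈ I, inner ℝ u (x i) = 0) ∧ ∀ j ∈ J, 0 < inner ℝ u (x j)

variable {d N : ℕ} {x : Fin N → EuclideanSpace ℝ (Fin d)}

theorem inner_eq_zero_of_mem_span {V : Type*} [NormedAddCommGroup V] [InnerProductSpace ℝ V]
    {s : Set V} {u y : V} (h : ∀ v ∈ s, inner ℝ u v = 0) (hy : y ∈ Submodule.span ℝ s) :
    inner ℝ u y = 0 := by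
  have : Submodule.span ℝ s ≤ LinearMap.ker (innerₛₗ ℝ u) := Submodule.span_le.2 h
  exact this hy

theorem sum_dite_smul {ι V : Type*} [Fintype ι] [DecidableEq ι] [AddCommGroup V] [Module ℝ V]
    (T : Finset ι) (c : {i // i ∈ T} → ℝ) (y : ι → V) :
    ∑ i, (if h : i ∈ T then c ⟨i, h⟩ else 0) • y i = ∑ j : {i // i ∈ T}, c j • y j := by
  rw [← Finset.sum_subset (Finset.subset_univ T) (fun i _ h => by simp [h]), ← Finset.sum_coe_sort]
  exact Finset.sum_congr rfl fun i _ => by rw [dif_pos i.2]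

theorem GeneralPosition.signs (hx : GeneralPosition x) (ε : Fin N → ℤˣ) :
    GeneralPosition (ε • x) := fun I hI =>
  (hx I hI).group_smul (fun i : (I : Set (Fin N)) => ε i)

theorem GeneralPosition.exists_orthogonal (hx : GeneralPosition x) {I : Finset (Fin N)}
    (hI : I.card < d) {j : Fin N} (hj : j ∉ I) :
    ∃ v : EuclideanSpace ℝ (Fin d), (∀ i ∈ I, inner ℝ v (x i) = 0) ∧ 0 < inner ℝ v (x j) := by
  have h1 := hx (insert j I) (by rw [Finset.card_insert_of_notMem hj]; exact hI)
  rw [Finset.coe_insert] at h1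
  have h2 := h1.notMem_span_of_insert (by simpa using hj)
  by_contra! hcon
  apply h2
  rw [← Submodule.orthogonal_orthogonal (Submodule.span ℝ (x '' (I : Set (Fin N)))),
    Submodule.mem_orthogonal]
  intro v hv
  have h0 : ∀ i ∈ I, inner ℝ v (x i) = 0 := fun i hi => by
    rw [real_inner_comm]
    exact (Submodule.mem_orthogonal _ v).1 hv _ (Submodule.subset_span ⟨i, hi, rfl⟩)
  have h3 := hcon v h0
  have h4 := hcon (-v) (fun i hi => by rw [inner_neg_left, h0 i hi, neg_zero])
  rw [inner_neg_left] at h4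
  linarith

theorem GeneralPosition.eq_zero_of_orthogonal (hx : GeneralPosition x) {I : Finset (Fin N)}
    (hI : d ≤ I.card) {u : EuclideanSpace ℝ (Fin d)} (hu : ∀ i ∈ I, inner ℝ u (x i) = 0) :
    u = 0 := by
  obtain ⟨K, hKI, hK⟩ := Finset.exists_subset_card_eq hI
  have h1 : Submodule.span ℝ (Set.range fun i : K => x i) = ⊤ :=
    LinearIndependent.span_eq_top_of_card_eq_finrank' (hx K hK.le) (by simp [hK])
  have h2 : u ∈ (Submodule.span ℝ (Set.range fun i : K => x i))ᗮ := by
    rw [Submodule.mem_orthogonal']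
    exact fun v hv => inner_eq_zero_of_mem_span (by rintro _ ⟨i, rfl⟩; exact hu i (hKI i.2)) hv
  rw [h1, Submodule.top_orthogonal_eq_bot] at h2
  simpa using h2

/-- Tilt `u` slightly towards a vector orthogonal to `I` and positive on `x j`: the finitely many
strict inequalities on `J` survive. -/
theorem GeneralPosition.separable_insert (hx : GeneralPosition x) {I J : Finset (Fin N)}
    (hI : I.card < d) {j : Fin N} (hj : j ∉ I) {u : EuclideanSpace ℝ (Fin d)}
    (h0 : ∀ i ∈ I, inner ℝ u (x i) = 0) (h1 : ∀ i ∈ J, 0 < inner ℝ u (x i))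
    (h2 : 0 ≤ inner ℝ u (x j)) : Separable I (insert j J) x := by
  obtain ⟨v, hv0, hvj⟩ := hx.exists_orthogonal hI hj
  have key : ∀ᶠ t : ℝ in 𝓝[>] 0, ∀ i ∈ J, 0 < inner ℝ (u + t • v) (x i) := by
    apply Filter.Eventually.filter_mono nhdsWithin_le_nhds
    rw [Filter.eventually_all_finset]
    intro i hi
    have hc : Continuous fun t : ℝ => (inner ℝ (u + t • v) (x i) : ℝ) := by fun_prop
    refine hc.continuousAt.eventually (lt_mem_nhds ?_)
    simpa using h1 i hi
  obtain ⟨t, ht, ht0⟩ := (key.and self_mem_nhdsWithin).exists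
  have ht0 : 0 < t := ht0
  refine ⟨u + t • v, fun i hi => ?_, fun i hi => ?_⟩
  · rw [inner_add_left, inner_smul_left, h0 i hi, hv0 i hi]; simp
  · rcases Finset.mem_insert.1 hi with rfl | hi
    · rw [inner_add_left, inner_smul_left]
      have := mul_pos ht0 hvj
      simp only [conj_trivial]
      linarith
    · exact ht i hi

/-- The sign vector `ε` with the sign at `j` reversed. -/
def flip (j : Fin N) (ε : Fin N → ℤˣ) : Fin N → ℤˣ := Function.update ε j (-ε j)

theorem flip_flip (j : Fin N) (ε : Fin N → ℤˣ) : flip j (flip j ε) = ε := by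
  simp [flip]

theorem flip_smul_self (j : Fin N) (ε : Fin N → ℤˣ) : (flip j ε • x) j = -(ε • x) j := by
  simp [flip]

theorem flip_smul_of_ne {i j : Fin N} (h : i ≠ j) (ε : Fin N → ℤˣ) :
    (flip j ε • x) i = (ε • x) i := by
  simp [flip, h]

/-- A separator for `J` has a weak sign on `x j`; one of the two signs at `j` makes it nonnegative,
and `separable_insert` makes it strict. -/
theorem GeneralPosition.separable_or_flip (hx : GeneralPosition x) {I J : Finset (Fin N)}
    (hI : I.card < d) {j : Fin N} (hj : j ∉ I) (hj' : j ∉ J) (ε : Fin N → ℤˣ) :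
    Separable I (insert j J) (ε • x) ∨ Separable I (insert j J) (flip j ε • x) ↔
      Separable I J (ε • x) := by
  have hne : ∀ K : Finset (Fin N), j ∉ K → ∀ i ∈ K, i ≠ j := fun K h i hi e => h (e ▸ hi)
  constructor
  · rintro (⟨u, h0, h1⟩ | ⟨u, h0, h1⟩)
    · exact ⟨u, h0, fun i hi => h1 i (Finset.mem_insert_of_mem hi)⟩
    · refine ⟨u, fun i hi => ?_, fun i hi => ?_⟩
      · rw [← flip_smul_of_ne (hne I hj i hi)]; exact h0 i hi
      · rw [← flip_smul_of_ne (hne J hj' i hi)]; exact h1 i (Finset.mem_insert_of_mem hi)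
  · rintro ⟨u, h0, h1⟩
    rcases le_total 0 (inner ℝ u ((ε • x) j)) with h | h
    · exact Or.inl ((hx.signs ε).separable_insert hI hj h0 h1 h)
    · refine Or.inr ((hx.signs (flip j ε)).separable_insert hI hj (u := u) (fun i hi => ?_)
        (fun i hi => ?_) ?_)
      · rw [flip_smul_of_ne (hne I hj i hi)]; exact h0 i hi
      · rw [flip_smul_of_ne (hne J hj' i hi)]; exact h1 i hi
      · rw [flip_smul_self, inner_neg_right]; linarith

/-- Separators on both sides of `x j` have a positive combination vanishing there; conversely, a
separator vanishing at `x j` can be tilted to either side. -/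
theorem GeneralPosition.separable_and_flip (hx : GeneralPosition x) {I J : Finset (Fin N)}
    (hI : I.card < d) {j : Fin N} (hj : j ∉ I) (hj' : j ∉ J) (ε : Fin N → ℤˣ) :
    Separable I (insert j J) (ε • x) ∧ Separable I (insert j J) (flip j ε • x) ↔
      Separable (insert j I) J (ε • x) := by
  have hne : ∀ K : Finset (Fin N), j ∉ K → ∀ i ∈ K, i ≠ j := fun K h i hi e => h (e ▸ hi)
  constructor
  · rintro ⟨⟨u, h0, h1⟩, ⟨v, g0, g1⟩⟩
    have hu := h1 j (Finset.mem_insert_self _ _)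
    have hv := g1 j (Finset.mem_insert_self _ _)
    rw [flip_smul_self, inner_neg_right] at hv
    -- Both weights are positive, and they cancel the value at `j`.
    refine ⟨(-inner ℝ v ((ε • x) j)) • u + (inner ℝ u ((ε • x) j)) • v, fun i hi => ?_,
      fun i hi => ?_⟩
    · rw [inner_add_left, real_inner_smul_left, real_inner_smul_left]
      rcases Finset.mem_insert.1 hi with rfl | hi
      · ring
      · have := g0 i hi
        rw [flip_smul_of_ne (hne I hj i hi)] at this
        rw [h0 i hi, this]; ring
    · have e1 := h1 i (Finset.mem_insert_of_mem hi)
      have e2 := g1 i (Finset.mem_insert_of_mem hi)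
      rw [flip_smul_of_ne (hne J hj' i hi)] at e2
      rw [inner_add_left, real_inner_smul_left, real_inner_smul_left]
      positivity
  · rintro ⟨u, h0, h1⟩
    have hj0 := h0 j (Finset.mem_insert_self _ _)
    constructor
    · exact (hx.signs ε).separable_insert hI hj
        (fun i hi => h0 i (Finset.mem_insert_of_mem hi)) h1 hj0.ge
    · refine (hx.signs (flip j ε)).separable_insert hI hj (u := u) (fun i hi => ?_)
        (fun i hi => ?_) ?_
      · rw [flip_smul_of_ne (hne I hj i hi)]; exact h0 i (Finset.mem_insert_of_mem hi)
      · rw [flip_smul_of_ne (hne J hj' i hi)]; exact h1 i hi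
      · rw [flip_smul_self, inner_neg_right, hj0, neg_zero]

open Classical in
/-- The number of sign vectors `ε` for which `ε • x` is separable. -/
noncomputable def numSigns (I J : Finset (Fin N)) (x : Fin N → EuclideanSpace ℝ (Fin d)) : ℕ :=
  (Finset.univ.filter fun ε : Fin N → ℤˣ => Separable I J (ε • x)).card

/-- Flipping is an involution, so the set counted on the left and its flip have equal size;
inclusion–exclusion for the two gives the recursion of `coverNum`. -/
theorem GeneralPosition.two_mul_numSigns_insert (hx : GeneralPosition x) {I J : Finset (Fin N)}
    (hI : I.card < d) {j : Fin N} (hj : j ∉ I) (hj' : j ∉ J) :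
    2 * numSigns I (insert j J) x = numSigns I J x + numSigns (insert j I) J x := by
  classical
  have e : numSigns I (insert j J) x =
      (Finset.univ.filter fun ε : Fin N → ℤˣ => Separable I (insert j J) (flip j ε • x)).card := by
    refine Finset.card_bij' (fun ε _ => flip j ε) (fun ε _ => flip j ε) ?_ ?_ ?_ ?_ <;>
      simp [flip_flip]
  rw [two_mul]
  nth_rw 2 [e]
  rw [numSigns, numSigns, numSigns, ← Finset.card_union_add_card_inter, ← Finset.filter_or,
    ← Finset.filter_and]
  congr 2
  · exact Finset.filter_congr fun ε _ => hx.separable_or_flip hI hj hj' ε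
  · exact Finset.filter_congr fun ε _ => hx.separable_and_flip hI hj hj' ε

theorem GeneralPosition.two_pow_mul_numSigns (hx : GeneralPosition x) (J : Finset (Fin N)) :
    ∀ I : Finset (Fin N), Disjoint I J → I.card ≤ d →
      2 ^ J.card * numSigns I J x = 2 ^ N * coverNum J.card (d - I.card) := by
  classical
  induction J using Finset.induction_on with
  | empty =>
    intro I _ _
    have : numSigns I ∅ x = 2 ^ N := by
      rw [numSigns, Finset.filter_true_of_mem (fun ε _ => ⟨0, by simp, by simp⟩)]
      simp
    simp [this, coverNum]
  | insert j J hj ih =>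
    intro I hIJ hI
    rw [Finset.disjoint_insert_right] at hIJ
    rw [Finset.card_insert_of_notMem hj]
    rcases hI.lt_or_eq with hlt | heq
    · have h1 := ih I hIJ.2 hI
      have h2 := ih (insert j I) (Finset.disjoint_insert_left.2 ⟨hj, hIJ.2⟩)
        (by rw [Finset.card_insert_of_notMem hIJ.1]; exact hlt)
      rw [Finset.card_insert_of_notMem hIJ.1] at h2
      obtain ⟨m, hm⟩ : ∃ m, d - I.card = m + 1 := ⟨d - I.card - 1, by omega⟩
      have hm' : d - (I.card + 1) = m := by omega
      rw [hm] at h1 ⊢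
      rw [hm'] at h2
      rw [pow_succ, mul_assoc, hx.two_mul_numSigns_insert hlt hIJ.1 hj, mul_add, h1, h2, coverNum,
        mul_add]
    -- With `d` orthogonality conditions only `u = 0` is left; this is the boundary value `coverNum
    -- (n + 1) 0 = 0`.
    · have : numSigns I (insert j J) x = 0 := by
        rw [numSigns, Finset.card_eq_zero, Finset.filter_eq_empty_iff]
        rintro ε - ⟨u, h0, h1⟩
        have hu : u = 0 := (hx.signs ε).eq_zero_of_orthogonal heq.ge h0
        have := h1 j (Finset.mem_insert_self _ _)
        simp [hu] at this
      simp [this, heq, coverNum]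

theorem GeneralPosition.numSigns_compl (hx : GeneralPosition x) (I : Finset (Fin N))
    (hI : I.card ≤ d) :
    numSigns I Iᶜ x = 2 ^ I.card * coverNum (N - I.card) (d - I.card) := by
  have h := hx.two_pow_mul_numSigns Iᶜ I disjoint_compl_right hI
  have hN : I.card ≤ N := by simpa using I.card_le_univ
  rw [Finset.card_compl, Fintype.card_fin] at h
  have e : 2 ^ N = 2 ^ (N - I.card) * 2 ^ I.card := by rw [← pow_add]; congr 1; omega
  rw [e, mul_assoc] at h
  exact Nat.eq_of_mul_eq_mul_left (by positivity) h

/-! ### Gordan's alternative and proper positive hulls. -/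

/-- Gordan's theorem of the alternative. -/
theorem exists_inner_pos_or_exists_sum_eq_zero {ι V : Type*} [Fintype ι] [NormedAddCommGroup V]
    [InnerProductSpace ℝ V] [FiniteDimensional ℝ V] (y : ι → V) :
    (∃ u : V, ∀ i, 0 < inner ℝ u (y i)) ∨
      ∃ c : ι → ℝ, (∀ i, 0 ≤ c i) ∧ ∑ i, c i = 1 ∧ ∑ i, c i • y i = 0 := by
  classical
  -- The image of the simplex is the convex hull of the `y i`, which is compact; if it misses the
  -- origin, Hahn–Banach separates them.
  by_cases h : (0 : V) ∈ Fintype.linearCombination ℝ y '' stdSimplex ℝ ι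
  · obtain ⟨c, hc, h0⟩ := h
    exact Or.inr ⟨c, hc.1, hc.2, by rwa [Fintype.linearCombination_apply] at h0⟩
  · left
    have hcont : Continuous (Fintype.linearCombination ℝ y) :=
      LinearMap.continuous_of_finiteDimensional _
    obtain ⟨f, r, hr, hf⟩ := geometric_hahn_banach_point_closed
      ((convex_stdSimplex ℝ ι).linear_image (Fintype.linearCombination ℝ y))
      ((isCompact_stdSimplex ℝ ι).image hcont).isClosed h
    refine ⟨(InnerProductSpace.toDual ℝ V).symm f, fun i => ?_⟩
    rw [InnerProductSpace.toDual_symm_apply]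
    rw [map_zero] at hr
    refine hr.trans (hf _ ⟨Pi.single i 1, single_mem_stdSimplex ℝ i, ?_⟩)
    simp [Fintype.linearCombination_apply_single]

/-- Gordan's alternative for the projections of the remaining vectors to the orthogonal complement
of the span of `I`. -/
theorem separable_compl_or_exists_sum_mem_span (I : Finset (Fin N))
    (x : Fin N → EuclideanSpace ℝ (Fin d)) :
    Separable I Iᶜ x ∨ ∃ c : Fin N → ℝ, (∀ i, 0 ≤ c i) ∧ (∀ i ∈ I, c i = 0) ∧ ∑ i, c i = 1 ∧
      ∑ i, c i • x i ∈ Submodule.span ℝ (x '' (I : Set (Fin N))) := by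
  classical
  set S := Submodule.span ℝ (x '' (I : Set (Fin N))) with hS
  rcases exists_inner_pos_or_exists_sum_eq_zero
    (fun j : {j // j ∈ Iᶜ} => Sᗮ.starProjection (x j)) with ⟨u, hu⟩ | ⟨c, hc, h1, h0⟩
  · refine Or.inl ⟨Sᗮ.starProjection u, fun i hi => ?_, fun i hi => ?_⟩
    · have := Submodule.starProjection_apply_mem Sᗮ u
      rw [Submodule.mem_orthogonal'] at this
      exact this _ (Submodule.subset_span ⟨i, hi, rfl⟩)
    · rw [Submodule.inner_starProjection_left_eq_right]
      exact hu ⟨i, hi⟩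
  · refine Or.inr ⟨fun i => if h : i ∈ Iᶜ then c ⟨i, h⟩ else 0, fun i => ?_, fun i hi => ?_, ?_, ?_⟩
    · dsimp only
      split_ifs
      · exact hc _
      · exact le_rfl
    · simp [hi]
    · rw [← h1, ← Finset.sum_subset (Finset.subset_univ Iᶜ) (fun i _ h => by simp [h]),
        ← Finset.sum_coe_sort]
      exact Finset.sum_congr rfl fun i _ => by rw [dif_pos i.2]
    · rw [sum_dite_smul, ← Submodule.orthogonal_orthogonal S,
        ← Submodule.starProjection_apply_eq_zero_iff, map_sum, ← h0]
      exact Finset.sum_congr rfl fun i _ => map_smul _ _ _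

theorem mem_pos {y : EuclideanSpace ℝ (Fin d)} :
    y ∈ pos x ↔ ∃ c : Fin N → ℝ, (∀ i, 0 ≤ c i) ∧ ∑ i, c i • x i = y := by
  rw [pos, PointedCone.hull, Submodule.mem_span_range_iff_exists_fun]
  constructor
  · rintro ⟨c, hc⟩
    exact ⟨fun i => c i, fun i => (c i).2, hc⟩
  · rintro ⟨c, hc, hy⟩
    exact ⟨fun i => ⟨c i, hc i⟩, hy⟩

theorem apply_mem_pos (x : Fin N → EuclideanSpace ℝ (Fin d)) (i : Fin N) : x i ∈ pos x :=
  PointedCone.subset_hull ⟨i, rfl⟩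

theorem Separable.pos_ne_top {I J : Finset (Fin N)} (h : Separable I J x) (hIJ : I ∪ J = Finset.univ)
    (hJ : J.Nonempty) : pos x ≠ ⊤ := by
  obtain ⟨u, h0, h1⟩ := h
  obtain ⟨j, hj⟩ := hJ
  intro htop
  obtain ⟨c, hc, hy⟩ := mem_pos.1 (htop ▸ Submodule.mem_top : -x j ∈ pos x)
  have := congrArg (fun v => (inner ℝ u v : ℝ)) hy
  simp only [inner_sum, inner_smul_right, inner_neg_right] at this
  have h2 : 0 ≤ ∑ i, c i * inner ℝ u (x i) := Finset.sum_nonneg fun i _ => by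
    refine mul_nonneg (hc i) ?_
    rcases Finset.mem_union.1 (hIJ ▸ Finset.mem_univ i) with hi | hi
    · exact (h0 i hi).ge
    · exact (h1 i hi).le
  have := h1 j hj
  linarith

/-- Without a separator there is a nontrivial nonnegative relation. General position forces at least
`d` positive coefficients in it, and the corresponding vectors span the space. -/
theorem GeneralPosition.pos_ne_top_iff (hx : GeneralPosition x) (hN : 0 < N) :
    pos x ≠ ⊤ ↔ Separable ∅ Finset.univ x := by
  constructor
  · intro htop
    rcases separable_compl_or_exists_sum_mem_span ∅ x with h | ⟨c, hc, -, h1, h0⟩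
    · simpa using h
    exfalso
    apply htop
    simp only [Finset.coe_empty, Set.image_empty, Submodule.span_empty, Submodule.mem_bot] at h0
    set K := Finset.univ.filter fun i => c i ≠ 0 with hK
    have hKd : d ≤ K.card := by
      by_contra! hlt
      have hli := hx K hlt.le
      have hsum : ∑ i ∈ K, c i • x i = 0 := by
        rw [← h0]
        exact Finset.sum_subset (Finset.subset_univ K) fun i _ h => by
          have : c i = 0 := by simpa [hK] using h
          simp [this]
      have hz := linearIndepOn_finset_iff.1 hli c hsum
      have : ∑ i, c i = 0 := Finset.sum_eq_zero fun i _ => by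
        by_contra hne
        exact hne (hz i (by simp [hK, hne]))
      linarith
    obtain ⟨T, hTK, hT⟩ := Finset.exists_subset_card_eq hKd
    have hspan : Submodule.span ℝ (Set.range fun i : T => x i) = ⊤ :=
      LinearIndependent.span_eq_top_of_card_eq_finrank' (hx T hT.le) (by simp [hT])
    rw [eq_top_iff]
    intro y _
    obtain ⟨b, hb⟩ := (Submodule.mem_span_range_iff_exists_fun ℝ).1
      (hspan ▸ Submodule.mem_top : y ∈ Submodule.span ℝ (Set.range fun i : T => x i))
    -- Adding a large multiple of the relation makes all coefficients nonnegative without changing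
    -- the sum.
    have hlarge : ∃ t : ℝ, 0 ≤ t ∧ ∀ i : T, 0 ≤ b i + t * c i := by
      have : ∀ᶠ t : ℝ in atTop, ∀ i : T, 0 ≤ b i + t * c i := by
        rw [eventually_all]
        intro i
        have hci : 0 < c i := lt_of_le_of_ne (hc i) (by
          have := hTK i.2; simp [hK] at this; exact Ne.symm this)
        exact (tendsto_atTop_add_const_left _ _
          (tendsto_id.atTop_mul_const hci)).eventually_ge_atTop 0
      obtain ⟨t, ht⟩ := ((eventually_ge_atTop (0 : ℝ)).and this).exists
      exact ⟨t, ht⟩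
    obtain ⟨t, ht0, ht⟩ := hlarge
    refine mem_pos.2 ⟨fun i => (if h : i ∈ T then b ⟨i, h⟩ else 0) + t * c i, fun i => ?_, ?_⟩
    · dsimp only
      split_ifs with h
      · exact ht ⟨i, h⟩
      · have := mul_nonneg ht0 (hc i); linarith
    · simp only [add_smul, Finset.sum_add_distrib, mul_smul, ← Finset.smul_sum, h0, smul_zero,
        add_zero]
      rw [← hb, sum_dite_smul]
  · intro h
    exact h.pos_ne_top (by simp) ⟨⟨0, hN⟩, Finset.mem_univ _⟩

/-! ### Faces of the positive hull. -/

/-- The positive hull of the vectors with index in `I`. -/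
def subPos (I : Finset (Fin N)) (x : Fin N → EuclideanSpace ℝ (Fin d)) :
    PointedCone ℝ (EuclideanSpace ℝ (Fin d)) :=
  PointedCone.hull ℝ (x '' (I : Set (Fin N)))

theorem subPos_le (I : Finset (Fin N)) (x : Fin N → EuclideanSpace ℝ (Fin d)) :
    subPos I x ≤ pos x :=
  Submodule.span_mono (Set.image_subset_range _ _)

theorem span_subPos (I : Finset (Fin N)) (x : Fin N → EuclideanSpace ℝ (Fin d)) :
    Submodule.span ℝ (subPos I x : Set (EuclideanSpace ℝ (Fin d))) =
      Submodule.span ℝ (x '' (I : Set (Fin N))) := by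
  apply le_antisymm
  · exact Submodule.span_le.2 (PointedCone.hull_le_span (R := ℝ) _)
  · exact Submodule.span_mono PointedCone.subset_hull

theorem sum_smul_mem_subPos {I : Finset (Fin N)} {c : Fin N → ℝ} (hc : ∀ i, 0 ≤ c i)
    (h : ∀ i, i ∉ I → c i = 0) : ∑ i, c i • x i ∈ subPos I x := by
  refine Submodule.sum_mem _ fun i _ => ?_
  by_cases hi : i ∈ I
  · exact (subPos I x).smul_mem (hc i) (Submodule.subset_span ⟨i, hi, rfl⟩)
  · rw [h i hi, zero_smul]; exact Submodule.zero_mem _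

theorem inner_eq_zero_of_mem_subPos {I : Finset (Fin N)} {u y : EuclideanSpace ℝ (Fin d)}
    (h0 : ∀ i ∈ I, inner ℝ u (x i) = 0) (hy : y ∈ subPos I x) : inner ℝ u y = 0 := by
  have hy' : y ∈ Submodule.span ℝ (x '' (I : Set (Fin N))) := PointedCone.hull_le_span (R := ℝ) _ hy
  exact inner_eq_zero_of_mem_span (by rintro _ ⟨i, hi, rfl⟩; exact h0 i hi) hy'

theorem mem_subPos_of_inner_eq_zero {I : Finset (Fin N)} {u y : EuclideanSpace ℝ (Fin d)}
    (h0 : ∀ i ∈ I, inner ℝ u (x i) = 0) (h1 : ∀ i ∈ Iᶜ, 0 < inner ℝ u (x i))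
    (hy : y ∈ pos x) (h : inner ℝ u y = 0) : y ∈ subPos I x := by
  obtain ⟨c, hc, rfl⟩ := mem_pos.1 hy
  refine sum_smul_mem_subPos hc fun i hi => ?_
  simp only [inner_sum, inner_smul_right] at h
  have hall := (Finset.sum_eq_zero_iff_of_nonneg fun i _ => by
    refine mul_nonneg (hc i) ?_
    by_cases hi : i ∈ I
    · exact (h0 i hi).ge
    · exact (h1 i (by simpa using hi)).le).1 h i (Finset.mem_univ i)
  exact (mul_eq_zero.1 hall).resolve_right (h1 i (by simpa using hi)).ne'

theorem inner_nonneg_of_mem_pos {I : Finset (Fin N)} {u y : EuclideanSpace ℝ (Fin d)}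
    (h0 : ∀ i ∈ I, inner ℝ u (x i) = 0) (h1 : ∀ i ∈ Iᶜ, 0 < inner ℝ u (x i))
    (hy : y ∈ pos x) : 0 ≤ inner ℝ u y := by
  obtain ⟨c, hc, rfl⟩ := mem_pos.1 hy
  simp only [inner_sum, inner_smul_right]
  refine Finset.sum_nonneg fun i _ => mul_nonneg (hc i) ?_
  by_cases hi : i ∈ I
  · exact (h0 i hi).ge
  · exact (h1 i (by simpa using hi)).le

/-- The separator `u` is nonnegative on the cone and vanishes on it exactly along `subPos I x`. -/
theorem Separable.isFaceOf {I : Finset (Fin N)} (h : Separable I Iᶜ x) :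
    (subPos I x).IsFaceOf (pos x) := by
  obtain ⟨u, h0, h1⟩ := h
  refine ⟨subPos_le I x, fun {y z a} hy hz ha hyz => ?_⟩
  have e := inner_eq_zero_of_mem_subPos h0 hyz
  rw [inner_add_right, real_inner_smul_right] at e
  have h2 := inner_nonneg_of_mem_pos h0 h1 hy
  have h3 := inner_nonneg_of_mem_pos h0 h1 hz
  refine mem_subPos_of_inner_eq_zero h0 h1 hy ?_
  nlinarith

theorem Separable.apply_mem_subPos_iff {I : Finset (Fin N)} (h : Separable I Iᶜ x) (i : Fin N) :
    x i ∈ subPos I x ↔ i ∈ I := by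
  refine ⟨fun hi => ?_, fun hi => PointedCone.subset_hull ⟨i, hi, rfl⟩⟩
  obtain ⟨u, h0, h1⟩ := h
  by_contra hn
  exact (h1 i (by simpa using hn)).ne' (inner_eq_zero_of_mem_subPos h0 hi)

/-- A face contains every generator that occurs with positive coefficient in one of its points. -/
theorem eq_subPos_of_isFaceOf {F : PointedCone ℝ (EuclideanSpace ℝ (Fin d))}
    (hF : F.IsFaceOf (pos x)) {I : Finset (Fin N)} (hI : ∀ i, i ∈ I ↔ x i ∈ F) :
    F = subPos I x := by
  apply le_antisymm
  · intro y hy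
    obtain ⟨c, hc, rfl⟩ := mem_pos.1 (hF.le hy)
    refine sum_smul_mem_subPos hc fun i hi => ?_
    by_contra hne
    exact hi ((hI i).2 (hF.mem_of_sum_smul_mem (apply_mem_pos x) hc hy i
      (lt_of_le_of_ne (hc i) (Ne.symm hne))))
  · refine Submodule.span_le.2 ?_
    rintro _ ⟨i, hi, rfl⟩
    exact (hI i).1 hi

/-- Faces of a finitely generated cone are exposed. Otherwise a convex combination of generators
outside the face lies in the span of those inside. -/
theorem separable_of_isFaceOf {F : PointedCone ℝ (EuclideanSpace ℝ (Fin d))}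
    (hF : F.IsFaceOf (pos x)) {I : Finset (Fin N)} (hI : ∀ i, i ∈ I ↔ x i ∈ F) :
    Separable I Iᶜ x := by
  rcases separable_compl_or_exists_sum_mem_span I x with h | ⟨c, hc, hcI, h1, hs⟩
  · exact h
  exfalso
  have hb : ∃ b : Fin N → ℝ, (∀ i, i ∉ I → b i = 0) ∧ ∑ i, b i • x i = ∑ i, c i • x i := by
    classical
    rw [Set.image_eq_range] at hs
    obtain ⟨b, hb⟩ := (Submodule.mem_span_range_iff_exists_fun ℝ).1 hs
    exact ⟨fun i => if h : i ∈ I then b ⟨i, h⟩ else 0, fun i hi => by simp [hi],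
      (sum_dite_smul I b x).trans hb⟩
  obtain ⟨b, hbI, hb⟩ := hb
  -- Moving the negative parts of `b` to the other side gives a point of the face in which every
  -- generator with `c i > 0` occurs.
  have hmem : ∑ i, (c i + (b i)⁻) • x i ∈ F := by
    have e : ∑ i, (c i + (b i)⁻) • x i = ∑ i, (b i)⁺ • x i := by
      simp only [add_smul]
      rw [Finset.sum_add_distrib, ← hb, ← Finset.sum_add_distrib]
      refine Finset.sum_congr rfl fun i _ => ?_
      rw [← add_smul]
      congr 1
      linarith [posPart_sub_negPart (b i)]
    rw [e, eq_subPos_of_isFaceOf hF hI]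
    exact sum_smul_mem_subPos (fun i => posPart_nonneg _) fun i hi => by simp [hbI i hi]
  have hz : ∀ i, c i = 0 := fun i => by
    by_contra hne
    have hpos : 0 < c i := lt_of_le_of_ne (hc i) (Ne.symm hne)
    refine hne (hcI i ((hI i).2 (hF.mem_of_sum_smul_mem (apply_mem_pos x)
      (fun i => add_nonneg (hc i) (negPart_nonneg (b i))) hmem i ?_)))
    have := negPart_nonneg (b i)
    linarith
  simp [hz] at h1

theorem GeneralPosition.finrank_span_of_card_le (hx : GeneralPosition x) {I : Finset (Fin N)}
    (hI : I.card ≤ d) : Module.finrank ℝ (Submodule.span ℝ (x '' (I : Set (Fin N)))) = I.card := by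
  have := finrank_span_eq_card (hx I hI)
  rw [Set.image_eq_range]
  simpa using this

-- The inverse of `I ↦ subPos I x` sends a face to the set of its generators. More than `d`
-- generators would give the face dimension at least `d > k`; otherwise they are independent, so
-- their number is the dimension.
open Classical in
theorem GeneralPosition.numFaces_eq (hx : GeneralPosition x) {k : ℕ} (hk : k < d) :
    numFaces k (pos x) =
      ((Finset.univ.powersetCard k).filter fun I : Finset (Fin N) => Separable I Iᶜ x).card := by
  rw [numFaces, ← Set.ncard_coe_finset]
  symm
  refine Set.ncard_congr (fun I _ => subPos I x) ?_ ?_ ?_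
  · intro I hI
    simp only [Finset.coe_filter, Finset.mem_powersetCard, Set.mem_ofPred_eq] at hI
    refine ⟨hI.2.isFaceOf, ?_⟩
    rw [span_subPos, hx.finrank_span_of_card_le (by omega), hI.1.2]
  · intro I K hI hK h
    simp only [Finset.coe_filter, Finset.mem_powersetCard, Set.mem_ofPred_eq] at hI hK
    ext i
    rw [← hI.2.apply_mem_subPos_iff, ← hK.2.apply_mem_subPos_iff, h]
  · rintro F ⟨hF, hdim⟩
    set I : Finset (Fin N) := Finset.univ.filter fun i => x i ∈ F with hI
    have hI' : ∀ i, i ∈ I ↔ x i ∈ F := fun i => by simp [hI]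
    have hFI := eq_subPos_of_isFaceOf hF hI'
    refine ⟨I, ?_, hFI.symm⟩
    simp only [Finset.coe_filter, Finset.mem_powersetCard, Set.mem_ofPred_eq]
    refine ⟨⟨Finset.subset_univ _, ?_⟩, separable_of_isFaceOf hF hI'⟩
    rw [hFI, span_subPos] at hdim
    rcases le_or_gt I.card d with h | h
    · rw [← hdim, hx.finrank_span_of_card_le h]
    · obtain ⟨K, hKI, hK⟩ := Finset.exists_subset_card_eq h.le
      have h1 := hx.finrank_span_of_card_le hK.le
      have h2 := Submodule.finrank_mono (R := ℝ) (Submodule.span_mono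
        (Set.image_mono (f := x) (Finset.coe_subset.2 hKI)))
      omega

/-! ### Measurability and almost sure general position. -/

theorem measurableSet_fst_image_of_isClosed {X Y : Type*} [TopologicalSpace X]
    [TopologicalSpace Y] [SigmaCompactSpace (X × Y)] [T2Space X] [MeasurableSpace X]
    [OpensMeasurableSpace X] {S : Set (X × Y)} (hS : IsClosed S) :
    MeasurableSet (Prod.fst '' S) := by
  obtain ⟨K, hK, hKS⟩ :=
    (isSigmaCompact_univ.of_isClosed_subset hS (Set.subset_univ S)).image continuous_fst
  rw [← hKS]
  exact MeasurableSet.iUnion fun n => (hK n).isClosed.measurableSet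

/-- Fubini, integrating over the coordinate `j` first. -/
theorem ae_pi_of_forall_ae_update {ι : Type*} [Fintype ι] [DecidableEq ι] {X : ι → Type*}
    [∀ i, MeasurableSpace (X i)] (μ : ∀ i, Measure (X i)) [∀ i, IsProbabilityMeasure (μ i)]
    {s : Set (∀ i, X i)} (hs : MeasurableSet s) (j : ι)
    (h : ∀ x, μ j {y | Function.update x j y ∈ s} = 0) : Measure.pi μ s = 0 := by
  have hne : ∀ i, Nonempty (X i) := fun i => nonempty_of_isProbabilityMeasure (μ i)
  rw [← lintegral_indicator_one hs,
    lintegral_eq_lmarginal_univ (fun i => Classical.choice (hne i)),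
    lmarginal_erase' _ (measurable_one.indicator hs) (Finset.mem_univ j)]
  have : (fun x : ∀ i, X i => ∫⁻ y, s.indicator (1 : (∀ i, X i) → ENNReal)
      (Function.update x j y) ∂μ j) = fun _ => 0 := by
    funext x
    have e : (fun y => s.indicator (1 : (∀ i, X i) → ENNReal) (Function.update x j y)) =
      {y | Function.update x j y ∈ s}.indicator 1 := rfl
    rw [e]
    exact (lintegral_indicator_one (measurable_update x hs)).trans (h x)
  rw [this]
  simp [lmarginal]

theorem Admissible.measure_submodule {φ : Measure (EuclideanSpace ℝ (Fin d))} (hφ : Admissible φ)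
    {S : Submodule ℝ (EuclideanSpace ℝ (Fin d))} (hS : S ≠ ⊤) : φ S = 0 := by
  have h1 : Sᗮ ≠ ⊥ := fun h => hS (by
    rw [← Submodule.orthogonal_orthogonal S, h, Submodule.bot_orthogonal_eq_top])
  obtain ⟨u, hu, hu0⟩ := (Submodule.ne_bot_iff _).1 h1
  refine measure_mono_null (fun y hy => ?_) (hφ.hyperplane u hu0)
  exact (Submodule.mem_orthogonal' _ u).1 hu y hy

theorem measurableSet_mem_span (I : Finset (Fin N)) (j : Fin N) :
    MeasurableSet {x : Fin N → EuclideanSpace ℝ (Fin d) |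
      x j ∈ Submodule.span ℝ (x '' (I : Set (Fin N)))} := by
  have e : {x : Fin N → EuclideanSpace ℝ (Fin d) |
      x j ∈ Submodule.span ℝ (x '' (I : Set (Fin N)))} =
      Prod.fst '' {p : (Fin N → EuclideanSpace ℝ (Fin d)) × (I → ℝ) |
        ∑ i, p.2 i • p.1 i = p.1 j} := by
    ext x
    rw [Set.mem_ofPred_eq, Set.image_eq_range, Submodule.mem_span_range_iff_exists_fun]
    constructor
    · rintro ⟨c, hc⟩
      exact ⟨(x, c), hc, rfl⟩
    · rintro ⟨⟨x, c⟩, hc, rfl⟩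
      exact ⟨c, hc⟩
  rw [e]
  exact measurableSet_fst_image_of_isClosed (isClosed_eq (by fun_prop) (by fun_prop))

/-- Given the vectors of `I`, fewer than `d` in number, the next one almost surely avoids their
span, which lies in a hyperplane. -/
theorem Admissible.ae_linearIndepOn {φ : Measure (EuclideanSpace ℝ (Fin d))} (hφ : Admissible φ)
    (I : Finset (Fin N)) : I.card ≤ d →
      ∀ᵐ x ∂(Measure.pi fun _ : Fin N => φ), LinearIndepOn ℝ x (I : Set (Fin N)) := by
  have := hφ.isProbabilityMeasure
  induction I using Finset.induction_on with
  | empty => intro _; simp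
  | insert j I hj ih =>
    intro hI
    rw [Finset.card_insert_of_notMem hj] at hI
    have h1 : ∀ᵐ x ∂(Measure.pi fun _ : Fin N => φ),
        x j ∉ Submodule.span ℝ (x '' (I : Set (Fin N))) := by
      rw [ae_iff]
      simp only [not_not]
      refine ae_pi_of_forall_ae_update _ (measurableSet_mem_span I j) j fun x => ?_
      have hS : Submodule.span ℝ (x '' (I : Set (Fin N))) ≠ ⊤ := fun h => by
        have h3 := finrank_range_le_card (R := ℝ) (fun i : I => x i)
        rw [Set.image_eq_range] at h
        erw [Set.finrank, h] at h3
        simp at h3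
        omega
      refine measure_mono_null (fun y hy => ?_) (hφ.measure_submodule hS)
      rw [Set.mem_ofPred_eq, Set.mem_ofPred_eq, Function.update_self] at hy
      rwa [Set.image_congr (g := x)] at hy
      intro i hi
      exact Function.update_of_ne (fun e => hj (by rw [← e]; exact hi)) _ _
    filter_upwards [ih (by omega), h1] with x hx hx1
    rw [Finset.coe_insert, linearIndepOn_insert (by simpa using hj)]
    exact ⟨hx, hx1⟩

theorem Admissible.ae_generalPosition {φ : Measure (EuclideanSpace ℝ (Fin d))}
    (hφ : Admissible φ) : ∀ᵐ x ∂(Measure.pi fun _ : Fin N => φ), GeneralPosition x := by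
  simp only [GeneralPosition, ae_all_iff]
  exact fun I hI => hφ.ae_linearIndepOn I hI

/-! ### Probabilities and expected face numbers. -/

theorem Admissible.measurePreserving_smul {φ : Measure (EuclideanSpace ℝ (Fin d))}
    (hφ : Admissible φ) (ε : Fin N → ℤˣ) :
    MeasurePreserving (fun x : Fin N → EuclideanSpace ℝ (Fin d) => ε • x)
      (Measure.pi fun _ => φ) (Measure.pi fun _ => φ) := by
  have := hφ.isProbabilityMeasure
  refine measurePreserving_pi (fun _ => φ) (fun _ => φ) (f := fun i y => ε i • y) fun i => ?_
  rcases Int.units_eq_one_or (ε i) with h | h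
  · simp only [h, one_smul]
    exact MeasurePreserving.id φ
  · simp only [h, Units.neg_smul, one_smul]
    exact ⟨measurable_neg, hφ.even⟩

theorem measurableSet_separable (I J : Finset (Fin N)) :
    MeasurableSet {x : Fin N → EuclideanSpace ℝ (Fin d) | Separable I J x} := by
  -- Rescaling `u` replaces `0 <` by `1 ≤`, so that the set becomes the projection of a closed set.
  have e : {x : Fin N → EuclideanSpace ℝ (Fin d) | Separable I J x} =
      Prod.fst '' {p : (Fin N → EuclideanSpace ℝ (Fin d)) × EuclideanSpace ℝ (Fin d) |
        (∀ i ∈ I, inner ℝ p.2 (p.1 i) = 0) ∧ ∀ j ∈ J, 1 ≤ inner ℝ p.2 (p.1 j)} := by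
    ext x
    constructor
    · rintro ⟨u, h0, h1⟩
      have : ∀ᶠ t : ℝ in atTop, ∀ j ∈ J, 1 ≤ t * inner ℝ u (x j) := by
        rw [Filter.eventually_all_finset]
        exact fun j hj => (tendsto_id.atTop_mul_const (h1 j hj)).eventually_ge_atTop 1
      obtain ⟨t, ht⟩ := this.exists
      refine ⟨(x, t • u), ⟨fun i hi => ?_, fun j hj => ?_⟩, rfl⟩
      · rw [real_inner_smul_left, h0 i hi, mul_zero]
      · rw [real_inner_smul_left]; exact ht j hj
    · rintro ⟨⟨x, u⟩, ⟨h0, h1⟩, rfl⟩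
      exact ⟨u, h0, fun j hj => zero_lt_one.trans_le (h1 j hj)⟩
  rw [e]
  have e' : {p : (Fin N → EuclideanSpace ℝ (Fin d)) × EuclideanSpace ℝ (Fin d) |
        (∀ i ∈ I, inner ℝ p.2 (p.1 i) = 0) ∧ ∀ j ∈ J, 1 ≤ inner ℝ p.2 (p.1 j)} =
      (⋂ i ∈ I, {p | inner ℝ p.2 (p.1 i) = 0}) ∩ ⋂ j ∈ J, {p | 1 ≤ inner ℝ p.2 (p.1 j)} := by
    ext p
    simp
  rw [e']
  exact measurableSet_fst_image_of_isClosed (IsClosed.inter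
    (isClosed_biInter fun i _ => isClosed_eq (by fun_prop) (by fun_prop))
    (isClosed_biInter fun i _ => isClosed_le (by fun_prop) (by fun_prop)))

/-- All `2 ^ N` sign changes of the event have the same probability, and the number of them that
occur is almost surely `m`. -/
theorem Admissible.two_pow_mul_measureReal_separable {φ : Measure (EuclideanSpace ℝ (Fin d))}
    (hφ : Admissible φ) {I J : Finset (Fin N)} {m : ℕ}
    (hm : ∀ x : Fin N → EuclideanSpace ℝ (Fin d), GeneralPosition x → numSigns I J x = m) :
    2 ^ N * (Measure.pi fun _ : Fin N => φ).real {x | Separable I J x} = m := by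
  classical
  have := hφ.isProbabilityMeasure
  set μ := Measure.pi fun _ : Fin N => φ with hμ
  have hS := measurableSet_separable (d := d) I J
  have h1 : ∀ ε : Fin N → ℤˣ, μ.real {x | Separable I J (ε • x)} = μ.real {x | Separable I J x} :=
    fun ε => (hφ.measurePreserving_smul ε).measureReal_preimage hS.nullMeasurableSet
  have hSε : ∀ ε : Fin N → ℤˣ, MeasurableSet {x : Fin N → EuclideanSpace ℝ (Fin d) |
      Separable I J (ε • x)} := fun ε => (hφ.measurePreserving_smul ε).measurable hS
  have h2 : ∫ x, (numSigns I J x : ℝ) ∂μ = 2 ^ N * μ.real {x | Separable I J x} := by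
    have e : (fun x : Fin N → EuclideanSpace ℝ (Fin d) => (numSigns I J x : ℝ)) =
        fun x => ∑ ε : Fin N → ℤˣ, {x | Separable I J (ε • x)}.indicator
            (1 : (Fin N → EuclideanSpace ℝ (Fin d)) → ℝ) x := by
      funext x
      simp [numSigns, Set.indicator_apply]
    rw [e, integral_finsetSum _ fun ε _ => (integrable_const 1).indicator (hSε ε)]
    simp [integral_indicator_one, hSε, h1]
  rw [← h2, integral_congr_ae (g := fun _ => (m : ℝ))]
  · simp
  · filter_upwards [hφ.ae_generalPosition] with x hx
    rw [hm x hx]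

theorem Admissible.expectedFaces_eq {φ : Measure (EuclideanSpace ℝ (Fin d))} (hφ : Admissible φ)
    {k : ℕ} (hk : k < d) (hN : d < N) :
    expectedFaces φ N k =
      N.choose k * (2 ^ k * coverNum (N - k) (d - k)) / coverNum N d := by
  classical
  have := hφ.isProbabilityMeasure
  set μ := Measure.pi fun _ : Fin N => φ with hμ
  set S : Set (Fin N → EuclideanSpace ℝ (Fin d)) := {x | Separable ∅ Finset.univ x} with hS
  have hSm : MeasurableSet S := measurableSet_separable _ _
  have hA : {x : Fin N → EuclideanSpace ℝ (Fin d) | pos x ≠ ⊤} =ᵐ[μ] S := by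
    filter_upwards [hφ.ae_generalPosition] with x hx
    exact propext (hx.pos_ne_top_iff (by omega))
  have hμS : 2 ^ N * μ.real S = coverNum N d := by
    have h := hφ.two_pow_mul_measureReal_separable (I := ∅) (J := Finset.univ) (N := N)
      (m := coverNum N d) fun x hx => by simpa using hx.numSigns_compl ∅ (by simp)
    exact h
  have hμI : ∀ I ∈ (Finset.univ : Finset (Fin N)).powersetCard k,
      2 ^ N * μ.real {x | Separable I Iᶜ x} = 2 ^ k * coverNum (N - k) (d - k) := by
    intro I hI
    have hc := (Finset.mem_powersetCard.1 hI).2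
    have h := hφ.two_pow_mul_measureReal_separable (I := I) (J := Iᶜ) (N := N)
      (m := 2 ^ k * coverNum (N - k) (d - k)) fun x hx => by
        have := hx.numSigns_compl I (by omega)
        rwa [hc] at this
    rw [h]; push_cast; rfl
  have hint : ∫ x in S, (numFaces k (pos x) : ℝ) ∂μ =
      ∑ I ∈ (Finset.univ : Finset (Fin N)).powersetCard k, μ.real {x | Separable I Iᶜ x} := by
    rw [← integral_indicator hSm]
    have e : S.indicator (fun x : Fin N → EuclideanSpace ℝ (Fin d) => (numFaces k (pos x) : ℝ))
        =ᵐ[μ] fun x => ∑ I ∈ (Finset.univ : Finset (Fin N)).powersetCard k,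
          {x | Separable I Iᶜ x}.indicator
            (1 : (Fin N → EuclideanSpace ℝ (Fin d)) → ℝ) x := by
      filter_upwards [hφ.ae_generalPosition] with x hx
      by_cases hxS : x ∈ S
      · rw [Set.indicator_of_mem hxS, hx.numFaces_eq hk]
        simp [Set.indicator_apply]
      · rw [Set.indicator_of_notMem hxS]
        -- Off `S` the cone is the whole space, and no `I` with nonempty complement is separable; so
        -- conditioning does not cut the face events.
        refine (Finset.sum_eq_zero fun I hI => Set.indicator_of_notMem (fun h => hxS ?_) _).symm
        have hc := (Finset.mem_powersetCard.1 hI).2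
        refine (hx.pos_ne_top_iff (by omega)).1 (Separable.pos_ne_top h (by simp) ?_)
        rw [← Finset.card_pos, Finset.card_compl, Fintype.card_fin]
        omega
    rw [integral_congr_ae e, integral_finsetSum _ fun I _ =>
      (integrable_const 1).indicator (measurableSet_separable I Iᶜ)]
    exact Finset.sum_congr rfl fun I _ => integral_indicator_one (measurableSet_separable I Iᶜ)
  rw [expectedFaces, ProbabilityTheory.cond, integral_smul_measure, measure_congr hA,
    Measure.restrict_congr_set hA, hint, ENNReal.toReal_inv, ← measureReal_def, smul_eq_mul]
  have hsum : 2 ^ N * ∑ I ∈ (Finset.univ : Finset (Fin N)).powersetCard k,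
      μ.real {x | Separable I Iᶜ x} = N.choose k * (2 ^ k * coverNum (N - k) (d - k)) := by
    rw [Finset.mul_sum, Finset.sum_congr rfl hμI]
    simp
  rw [← hsum, ← hμS, mul_div_mul_left _ _ (by positivity), inv_mul_eq_div]

/-! ### Identities and bounds for `coverNum`. -/

theorem coverNum_succ_succ_eq_add (n m : ℕ) :
    coverNum (n + 1) (m + 1) = coverNum (n + 1) m + 2 * n.choose m := by
  induction n generalizing m with
  | zero => cases m <;> simp [coverNum]
  | succ n ih =>
    cases m with
    | zero =>
      rw [show coverNum (n + 1 + 1) (0 + 1) = coverNum (n + 1) (0 + 1) + coverNum (n + 1) 0 from rfl,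
        ih 0]
      simp [coverNum]
    | succ m =>
      rw [coverNum, ih (m + 1), ih m, Nat.choose_succ_succ, coverNum, ih m]
      ring

theorem coverNum_succ_eq_sum (n m : ℕ) :
    coverNum (n + 1) m = 2 * ∑ i ∈ Finset.range m, n.choose i := by
  induction m with
  | zero => simp [coverNum]
  | succ m ih => rw [coverNum_succ_succ_eq_add, ih, Finset.sum_range_succ]; ring

/-- A diagonal step doubles the count up to one binomial coefficient; `k` such steps lead from `(N -
k, d - k)` to `(N, d)`. -/
theorem coverNum_succ_succ_eq_two_mul_add (n m : ℕ) :
    coverNum (n + 2) (m + 1) = 2 * coverNum (n + 1) m + 2 * n.choose m := by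
  rw [coverNum, coverNum_succ_succ_eq_add]
  ring

theorem coverNum_le_two_pow (n m : ℕ) : coverNum n m ≤ 2 ^ n := by
  induction n generalizing m with
  | zero => simp [coverNum]
  | succ n ih =>
    cases m with
    | zero => simp [coverNum]
    | succ m =>
      have h1 := ih (m + 1)
      have h2 := ih m
      rw [coverNum, pow_succ]
      omega

theorem two_pow_le_two_mul_coverNum {n m : ℕ} (h : n ≤ 2 * m) : 2 ^ n ≤ 2 * coverNum n m := by
  induction n generalizing m with
  | zero => simp [coverNum]
  | succ n ih =>
    obtain ⟨m, rfl⟩ : ∃ l, m = l + 1 := ⟨m - 1, by omega⟩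
    rcases Nat.lt_or_ge (2 * m) n with hlt | hge
    -- The extreme case, with equality: half of row `2 * m + 1` of Pascal's triangle sums to `4 ^
    -- m`.
    · obtain rfl : n = 2 * m + 1 := by omega
      rw [coverNum_succ_eq_sum, Nat.sum_range_choose_halfway, pow_succ, pow_succ, pow_mul]
      norm_num
      omega
    · have h1 := ih hge
      have h2 := ih (m := m + 1) (by omega)
      rw [coverNum, pow_succ]
      omega

theorem coverNum_pos (n m : ℕ) : 0 < coverNum (n + 1) (m + 1) := by
  rw [coverNum_succ_eq_sum, Finset.sum_range_succ']
  simp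

/-- Only the first term of the telescoped sum is kept; `k + 1` steps ensure that there is one. -/
theorem two_pow_mul_choose_le_coverNum (n m k : ℕ) :
    2 ^ (k + 1) * coverNum (n + 1) m + 2 ^ (k + 1) * n.choose m ≤
      coverNum (n + 1 + (k + 1)) (m + (k + 1)) := by
  induction k with
  | zero => rw [coverNum_succ_succ_eq_two_mul_add]; simp
  | succ k ih =>
    have := coverNum_succ_succ_eq_two_mul_add (n + (k + 1)) (m + (k + 1))
    rw [show n + 1 + (k + 1 + 1) = n + (k + 1) + 2 by ring,
      show m + (k + 1 + 1) = m + (k + 1) + 1 by ring, this,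
      show n + (k + 1) + 1 = n + 1 + (k + 1) by ring, pow_succ 2 (k + 1)]
    linarith [Nat.zero_le ((n + (k + 1)).choose (m + (k + 1)))]

/-- The ratio of neighbours on the diagonal is `(n + j + 1) / (m + j + 1)`; since `1 ≤ 2 * q`, the
bound `2 * q` at `j = 0` persists. -/
theorem choose_add_add_le {n m : ℕ} {q : ℝ} (hq : 1 / 2 ≤ q)
    (h : (n : ℝ) + 1 ≤ 2 * q * (m + 1)) (j : ℕ) :
    ((n + j).choose (m + j) : ℝ) ≤ (2 * q) ^ j * n.choose m := by
  induction j with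
  | zero => simp
  | succ j ih =>
    have h1 : (((n + j) + 1 : ℕ) : ℝ) * (n + j).choose (m + j) =
        ((n + j) + 1).choose ((m + j) + 1) * (((m + j) + 1 : ℕ) : ℝ) := by
      exact_mod_cast Nat.add_one_mul_choose_eq (n + j) (m + j)
    push_cast at h1
    have hpos : (0 : ℝ) < (m : ℝ) + j + 1 := by positivity
    have h2 : ((n : ℝ) + j + 1) ≤ 2 * q * (m + j + 1) := by
      have : (0 : ℝ) ≤ (2 * q - 1) * j := mul_nonneg (by linarith) (Nat.cast_nonneg j)
      nlinarith
    rw [← mul_le_mul_iff_left₀ hpos]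
    calc (((n + (j + 1)).choose (m + (j + 1)) : ℕ) : ℝ) * (m + j + 1)
        = ((n : ℝ) + j + 1) * (n + j).choose (m + j) := h1.symm
      _ ≤ (2 * q * (m + j + 1)) * ((2 * q) ^ j * n.choose m) := by gcongr
      _ = (2 * q) ^ (j + 1) * n.choose m * (m + j + 1) := by ring

/-- After division by the powers of 2, the telescoped sum is dominated by a geometric series of
ratio `q`. -/
theorem coverNum_le_add_of_le {n m : ℕ} {q : ℝ} (hq : 1 / 2 ≤ q) (hq1 : q < 1)
    (h : (n : ℝ) + 1 ≤ 2 * q * (m + 1)) (k : ℕ) :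
    (coverNum (n + 1 + k) (m + k) : ℝ) ≤
      2 ^ k * coverNum (n + 1) m + 2 ^ k * n.choose m * ((1 - q ^ k) / (1 - q)) := by
  induction k with
  | zero => simp
  | succ k ih =>
    have h1 := coverNum_succ_succ_eq_two_mul_add (n + k) (m + k)
    rw [show n + 1 + (k + 1) = n + k + 2 by ring, show m + (k + 1) = m + k + 1 by ring, h1,
      show n + k + 1 = n + 1 + k by ring]
    push_cast
    have h2 := choose_add_add_le hq h k
    have e : (1 - q ^ (k + 1)) / (1 - q) = (1 - q ^ k) / (1 - q) + q ^ k := by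
      have : 1 - q ≠ 0 := by linarith
      field_simp
      ring
    rw [e]
    rw [mul_pow] at h2
    calc 2 * (coverNum (n + 1 + k) (m + k) : ℝ) + 2 * (n + k).choose (m + k)
        ≤ 2 * (2 ^ k * coverNum (n + 1) m + 2 ^ k * n.choose m * ((1 - q ^ k) / (1 - q))) +
          2 * (2 ^ k * q ^ k * n.choose m) := by gcongr
      _ = _ := by ring

/-! ### Comparison of the deficit with its leading term. -/

/-- The leading term of the face deficit. -/
noncomputable def leadingTerm (N d k : ℕ) : ℝ :=
  N.choose k * (N - k - 1).choose (d - k) * 2 ^ k / 2 ^ N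

variable {k : ℕ} {φ : Measure (EuclideanSpace ℝ (Fin d))}

theorem Admissible.faceDeficit_eq (hφ : Admissible φ) (hk : k < d) (hN : d < N) :
    faceDeficit φ N k =
      N.choose k * (coverNum N d - 2 ^ k * coverNum (N - k) (d - k)) / coverNum N d := by
  have : (coverNum N d : ℝ) ≠ 0 := by
    obtain ⟨n, rfl⟩ : ∃ n, N = n + 1 := ⟨N - 1, by omega⟩
    obtain ⟨m, rfl⟩ : ∃ m, d = m + 1 := ⟨d - 1, by omega⟩
    exact_mod_cast (coverNum_pos n m).ne'
  rw [faceDeficit, hφ.expectedFaces_eq hk hN]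
  field_simp

theorem leadingTerm_pos (hk : k < d) (hN : d < N) : 0 < leadingTerm N d k := by
  have h1 := Nat.choose_pos (show k ≤ N by omega)
  have h2 := Nat.choose_pos (show d - k ≤ N - k - 1 by omega)
  rw [leadingTerm]
  positivity

theorem Admissible.leadingTerm_le_faceDeficit (hφ : Admissible φ) (hk1 : 1 ≤ k) (hk : k < d)
    (hN : d < N) : leadingTerm N d k ≤ faceDeficit φ N k := by
  rw [hφ.faceDeficit_eq hk hN, leadingTerm]
  have h1 := two_pow_mul_choose_le_coverNum (N - k - 1) (d - k) (k - 1)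
  rw [show k - 1 + 1 = k by omega, show N - k - 1 + 1 = N - k by omega,
    show N - k + k = N by omega, show d - k + k = d by omega] at h1
  have h1' : (2 : ℝ) ^ k * coverNum (N - k) (d - k) + 2 ^ k * (N - k - 1).choose (d - k) ≤
    coverNum N d := by exact_mod_cast h1
  have h2 : (coverNum N d : ℝ) ≤ 2 ^ N := by exact_mod_cast coverNum_le_two_pow N d
  have h3 : (0 : ℝ) < 2 ^ k * (N - k - 1).choose (d - k) := by
    have := Nat.choose_pos (show d - k ≤ N - k - 1 by omega)
    positivity
  have h4 : (0 : ℝ) ≤ 2 ^ k * coverNum (N - k) (d - k) := by positivity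
  refine div_le_div₀ (mul_nonneg (Nat.cast_nonneg _) (by linarith)) ?_ (by linarith) h2
  rw [mul_assoc]
  refine mul_le_mul_of_nonneg_left ?_ (Nat.cast_nonneg _)
  linarith

/-- The factor `1 / (1 - q)` is the geometric series; the 2 comes from `2 ^ N ≤ 2 * coverNum N d`.
-/
theorem Admissible.faceDeficit_le (hφ : Admissible φ) (hk : k < d)
    (hN : d < N) (hN2 : N ≤ 2 * d) {q : ℝ} (hq : 1 / 2 ≤ q) (hq1 : q < 1)
    (h : (N : ℝ) - k ≤ 2 * q * (d - k)) :
    faceDeficit φ N k ≤ 2 / (1 - q) * leadingTerm N d k := by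
  rw [hφ.faceDeficit_eq hk hN, leadingTerm]
  have h1 := coverNum_le_add_of_le (n := N - k - 1) (m := d - k) hq hq1 (by
    rw [← Nat.cast_add_one, show N - k - 1 + 1 = N - k by omega, Nat.cast_sub (by omega),
      Nat.cast_sub hk.le]
    linarith) k
  rw [show N - k - 1 + 1 = N - k by omega,
    show N - k + k = N by omega, show d - k + k = d by omega] at h1
  have h2 : (2 : ℝ) ^ N ≤ 2 * coverNum N d := by exact_mod_cast two_pow_le_two_mul_coverNum hN2
  have h3 : (0 : ℝ) < 2 ^ N := by positivity
  have h4 : (1 - q ^ k) / (1 - q) ≤ 1 / (1 - q) := by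
    have : 0 ≤ q ^ k := by positivity
    have : 0 < 1 - q := by linarith
    gcongr
    linarith
  have h5 : (coverNum N d : ℝ) - 2 ^ k * coverNum (N - k) (d - k) ≤
      2 ^ k * (N - k - 1).choose (d - k) * (1 / (1 - q)) := by
    have := mul_le_mul_of_nonneg_left h4
      (by positivity : (0 : ℝ) ≤ 2 ^ k * (N - k - 1).choose (d - k))
    linarith
  have h6 : 0 < 1 - q := by linarith
  calc (N.choose k : ℝ) * (coverNum N d - 2 ^ k * coverNum (N - k) (d - k)) / coverNum N d
      ≤ N.choose k * (2 ^ k * (N - k - 1).choose (d - k) * (1 / (1 - q))) / coverNum N d := by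
        gcongr
    _ ≤ N.choose k * (2 ^ k * (N - k - 1).choose (d - k) * (1 / (1 - q))) / (2 ^ N / 2) := by
        gcongr
        linarith
    _ = _ := by field_simp

/-- Regrouping the binomials brings out the ratios `d / N` and `k / d` on which `G` depends. -/
theorem leadingTerm_eq (hk : k < d) (hN : d < N) :
    leadingTerm N d k =
      N.choose d * d.choose k * (((N : ℝ) - d) / (N - k)) * (2 ^ k / 2 ^ N) := by
  have h1 := Nat.choose_mul (n := N) (k := d) (s := k) hk.le
  have h2 := Nat.choose_mul_succ_eq (N - k - 1) (d - k)
  rw [show N - k - 1 + 1 = N - k by omega, show N - k - (d - k) = N - d by omega] at h2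
  have h1' : (N.choose d * d.choose k : ℝ) = N.choose k * (N - k).choose (d - k) := by
    exact_mod_cast h1
  have h2' : ((N - k - 1).choose (d - k) : ℝ) * (N - k) = (N - k).choose (d - k) * (N - d) := by
    rw [← Nat.cast_sub hN.le, ← Nat.cast_sub (by omega : k ≤ N)]
    exact_mod_cast h2
  have h3 : (N : ℝ) - k ≠ 0 := by
    have : (k : ℝ) < N := by exact_mod_cast hk.trans hN
    linarith
  rw [h1', leadingTerm]
  field_simp
  linear_combination (N.choose k : ℝ) * h2'

/-! ### Stirling bounds. -/

theorem one_le_stirlingSeq {n : ℕ} (hn : n ≠ 0) : 1 ≤ Stirling.stirlingSeq n := by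
  refine le_trans ?_ (Stirling.sqrt_pi_le_stirlingSeq hn)
  rw [Real.one_le_sqrt]
  linarith [Real.pi_gt_three]

/-- The sequence decreases from e/√2. Crude bounds valid for every nonzero index suffice, as only
the order of magnitude matters. -/
theorem stirlingSeq_le_two {n : ℕ} (hn : n ≠ 0) : Stirling.stirlingSeq n ≤ 2 := by
  obtain ⟨m, rfl⟩ := Nat.exists_eq_succ_of_ne_zero hn
  refine (Stirling.stirlingSeq'_antitone (Nat.zero_le m)).trans ?_
  simp only [Function.comp, Nat.succ_eq_add_one, zero_add, Stirling.stirlingSeq_one]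
  rw [div_le_iff₀ (by positivity)]
  have h1 := Real.exp_one_lt_d9
  have h2 : (1.4 : ℝ) ≤ √2 := Real.le_sqrt_of_sq_le (by norm_num)
  linarith

theorem factorial_eq_stirlingSeq_mul {n : ℕ} (hn : n ≠ 0) :
    (n.factorial : ℝ) =
      Stirling.stirlingSeq n * √(2 * n) * Real.exp (n * Real.log n - n) := by
  have hn0 : (0 : ℝ) < n := by positivity
  have : Real.exp (n * Real.log n - n) = (n / Real.exp 1) ^ n := by
    rw [Real.exp_sub, div_pow, ← Real.exp_nat_mul, mul_one, Real.exp_nat_mul, Real.exp_log hn0]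
  rw [this, Stirling.stirlingSeq]
  field_simp

theorem mul_binEntropy_div {n m : ℝ} (hm : 0 < m) (hmn : m < n) :
    n * Real.binEntropy (m / n) =
      n * Real.log n - m * Real.log m - (n - m) * Real.log (n - m) := by
  have hn : 0 < n := hm.trans hmn
  have e : 1 - m / n = (n - m) / n := by field_simp
  rw [Real.binEntropy, e, Real.log_inv, Real.log_inv, Real.log_div hm.ne' hn.ne',
    Real.log_div (by linarith) hn.ne']
  field_simp
  ring

theorem choose_eq_stirlingSeq {n m : ℕ} (hm : 0 < m) (hmn : m < n) :
    (n.choose m : ℝ) = Stirling.stirlingSeq n /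
      (Stirling.stirlingSeq m * Stirling.stirlingSeq (n - m)) *
      (√(2 * (m / n) * (1 - m / n)))⁻¹ * (√n)⁻¹ * Real.exp (n * Real.binEntropy (m / n)) := by
  have hm0 : (0 : ℝ) < m := by exact_mod_cast hm
  have hmn0 : (m : ℝ) < n := by exact_mod_cast hmn
  have hn0 : (0 : ℝ) < n := hm0.trans hmn0
  have hs1 := one_le_stirlingSeq (n := m) (by omega)
  have hs2 := one_le_stirlingSeq (n := n - m) (by omega)
  rw [Nat.cast_choose ℝ hmn.le, factorial_eq_stirlingSeq_mul (by omega : n ≠ 0),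
    factorial_eq_stirlingSeq_mul (by omega : m ≠ 0),
    factorial_eq_stirlingSeq_mul (by omega : n - m ≠ 0), mul_binEntropy_div hm0 hmn0,
    Nat.cast_sub hmn.le]
  have e1 : Real.exp (n * Real.log n - m * Real.log m - (n - m) * Real.log (n - m)) =
      Real.exp (n * Real.log n - n) / (Real.exp (m * Real.log m - m) *
        Real.exp ((n - m) * Real.log (n - m) - (n - m))) := by
    rw [← Real.exp_add, ← Real.exp_sub]
    congr 1
    ring
  have e2 : √(2 * m) * √(2 * ((n : ℝ) - m)) =
      √(2 * n) * √(2 * (m / n) * (1 - m / n)) * √n := by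
    have h1 : (0 : ℝ) ≤ 2 * n := by positivity
    have h2 : (0 : ℝ) ≤ 1 - m / n := by
      rw [sub_nonneg, div_le_one hn0]; exact hmn0.le
    rw [← Real.sqrt_mul (by positivity), ← Real.sqrt_mul h1,
      ← Real.sqrt_mul (by positivity)]
    congr 1
    field_simp
  have h3 : 0 < √((2 : ℝ) * n) := by positivity
  have h4 : 0 < √((2 : ℝ) * m) := by positivity
  have h5 : 0 < √((2 : ℝ) * ((n : ℝ) - m)) := Real.sqrt_pos.2 (by linarith)
  have e3 : (√(2 * ((m : ℝ) / n) * (1 - m / n)))⁻¹ * (√(n : ℝ))⁻¹ =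
      √(2 * n) / (√(2 * m) * √(2 * ((n : ℝ) - m))) := by
    rw [e2]
    field_simp
  rw [e1, mul_assoc (_ / _) _ (√(n : ℝ))⁻¹, e3]
  field_simp

theorem choose_mem_Icc {n m : ℕ} (hm : 0 < m) (hmn : m < n) :
    (n.choose m : ℝ) / ((√(2 * (m / n) * (1 - m / n)))⁻¹ * (√n)⁻¹ *
      Real.exp (n * Real.binEntropy (m / n))) ∈ Set.Icc (1 / 4) 2 := by
  have hm0 : (0 : ℝ) < m := by exact_mod_cast hm
  have hmn0 : (m : ℝ) < n := by exact_mod_cast hmn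
  have hn0 : (0 : ℝ) < n := hm0.trans hmn0
  have h2 : (0 : ℝ) < 1 - m / n := by
    rw [sub_pos, div_lt_one hn0]; exact hmn0
  have h3 : 0 < √(2 * ((m : ℝ) / n) * (1 - m / n)) := by positivity
  rw [choose_eq_stirlingSeq hm hmn, mul_assoc (_ / _), mul_assoc (_ / _),
    mul_div_cancel_right₀ _ (by positivity)]
  have a1 := one_le_stirlingSeq (n := n) (by omega)
  have a2 := one_le_stirlingSeq (n := m) (by omega)
  have a3 := one_le_stirlingSeq (n := n - m) (by omega)
  have b1 := stirlingSeq_le_two (n := n) (by omega)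
  have b2 := stirlingSeq_le_two (n := m) (by omega)
  have b3 := stirlingSeq_le_two (n := n - m) (by omega)
  constructor
  · rw [div_le_div_iff₀ (by norm_num) (by positivity)]
    nlinarith
  · rw [div_le_iff₀ (by positivity)]
    nlinarith

/-- The subexponential factor of the leading term of the face deficit, up to Stirling ratios. -/
noncomputable def weight (δ ρ : ℝ) : ℝ :=
  (√(2 * δ * (1 - δ)))⁻¹ * (√(2 * ρ * (1 - ρ)))⁻¹ * (√δ)⁻¹ * ((1 - δ) / (1 - δ * ρ))

/-- The binomials and `2 ^ k / 2 ^ N` give exactly the exponent `N * G`. Their Stirling factors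
contribute 1/√(Nd), which is 1/(N√δ) with δ = d/N; this is the source of 1/N. The constants are
products of the bounds 1/4 and 2. -/
theorem leadingTerm_div_mem_Icc (hk1 : 1 ≤ k) (hk : k < d) (hN : d < N) :
    leadingTerm N d k * (N * Real.exp (-(N * G (d / N) (k / d)))) ∈
      Set.Icc (1 / 16 * weight (d / N) (k / d)) (4 * weight (d / N) (k / d)) := by
  have hk0 : (0 : ℝ) < k := by exact_mod_cast hk1
  have hkd : (k : ℝ) < d := by exact_mod_cast hk
  have hdN : (d : ℝ) < N := by exact_mod_cast hN
  have hd0 : (0 : ℝ) < d := hk0.trans hkd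
  have hN0 : (0 : ℝ) < N := hd0.trans hdN
  have h1 := choose_mem_Icc (n := N) (m := d) (by omega) hN
  have h2 := choose_mem_Icc (n := d) (m := k) hk1 hk
  have c1 : (0 : ℝ) < 1 - d / N := by rw [sub_pos, div_lt_one hN0]; exact hdN
  have c2 : (0 : ℝ) < 1 - k / d := by rw [sub_pos, div_lt_one hd0]; exact hkd
  set A := (√(2 * ((d : ℝ) / N) * (1 - d / N)))⁻¹ with hA
  set B := (√(2 * ((k : ℝ) / d) * (1 - k / d)))⁻¹ with hB
  have hA0 : 0 < A := by positivity
  have hB0 : 0 < B := by positivity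
  set X := (N.choose d : ℝ) / (A * (√(N : ℝ))⁻¹ * Real.exp (N * Real.binEntropy (d / N))) with hX
  set Y := (d.choose k : ℝ) / (B * (√(d : ℝ))⁻¹ * Real.exp (d * Real.binEntropy (k / d))) with hY
  have hX' : (N.choose d : ℝ) = X * (A * (√(N : ℝ))⁻¹ * Real.exp (N * Real.binEntropy (d / N))) := by
    rw [hX, div_mul_cancel₀ _ (by positivity)]
  have hY' : (d.choose k : ℝ) = Y * (B * (√(d : ℝ))⁻¹ * Real.exp (d * Real.binEntropy (k / d))) := by
    rw [hY, div_mul_cancel₀ _ (by positivity)]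
  have e1 : Real.exp (-(N * G (d / N) (k / d))) =
      (Real.exp (N * Real.binEntropy (d / N)))⁻¹ * (Real.exp (d * Real.binEntropy (k / d)))⁻¹ *
        (2 ^ N / 2 ^ k) := by
    have p : ∀ n : ℕ, (2 : ℝ) ^ n = Real.exp (n * Real.log 2) := fun n => by
      rw [Real.exp_nat_mul, Real.exp_log (by norm_num)]
    rw [p N, p k, ← Real.exp_sub, ← Real.exp_neg, ← Real.exp_neg, ← Real.exp_add, ← Real.exp_add]
    congr 1
    rw [G]
    field_simp
    ring
  have e2 : (√((d : ℝ) / N))⁻¹ = N * (√(N : ℝ))⁻¹ * (√(d : ℝ))⁻¹ := by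
    rw [Real.sqrt_div hd0.le]
    have := Real.mul_self_sqrt hN0.le
    field_simp
    nlinarith
  have e3 : ((N : ℝ) - d) / (N - k) = (1 - d / N) / (1 - d / N * (k / d)) := by
    have : (N : ℝ) - k ≠ 0 := by linarith
    have h : 1 - (d : ℝ) / N * (k / d) = (N - k) / N := by field_simp
    rw [h]
    field_simp
  have hW : leadingTerm N d k * (N * Real.exp (-(N * G (d / N) (k / d)))) =
      X * Y * weight (d / N) (k / d) := by
    rw [leadingTerm_eq hk hN, weight, ← hA, ← hB, e1, e2, ← e3, hX', hY']
    field_simp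
  have hW0 : 0 ≤ weight (d / N) (k / d) := by
    rw [weight, ← e3]
    have : (0 : ℝ) < N - d := by linarith
    have : (0 : ℝ) < N - k := by linarith
    positivity
  rw [hW]
  constructor
  · refine mul_le_mul_of_nonneg_right ?_ hW0
    nlinarith [h1.1, h2.1]
  · refine mul_le_mul_of_nonneg_right ?_ hW0
    nlinarith [h1.1, h2.1, h1.2, h2.2]

/-! ### The sign of `G` on either side of `rhoS`. -/

theorem continuous_G (δ : ℝ) : Continuous (G δ) := by
  unfold G
  fun_prop

theorem G_zero_neg {δ : ℝ} (h₁ : 1 / 2 < δ) : G δ 0 < 0 := by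
  have : Real.binEntropy δ < Real.log 2 :=
    Real.binEntropy_lt_log_two.2 (by intro h; norm_num [h] at h₁)
  simp only [G, Real.binEntropy_zero]
  linarith

theorem G_one_pos {δ : ℝ} (h₁ : 1 / 2 < δ) (h₂ : δ < 1) : 0 < G δ 1 := by
  have hl : 0 < Real.log 2 := Real.log_pos (by norm_num)
  have := Real.strictConcave_binEntropy.concaveOn.2
    (show (2⁻¹ : ℝ) ∈ Set.Icc (0 : ℝ) 1 by norm_num)
    (show (1 : ℝ) ∈ Set.Icc (0 : ℝ) 1 by norm_num)
    (show 0 ≤ 2 * (1 - δ) by linarith) (show 0 ≤ 2 * δ - 1 by linarith) (by ring)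
  simp only [smul_eq_mul, Real.binEntropy_two_inv, Real.binEntropy_one] at this
  rw [show 2 * (1 - δ) * 2⁻¹ + (2 * δ - 1) * 1 = δ by ring] at this
  simp only [G, Real.binEntropy_one]
  nlinarith [mul_pos (sub_pos.2 h₂) hl]

/-- A nonnegative value would give a zero in `[0, ρ]`, below the only one. -/
theorem G_neg_of_lt_rhoS {δ ρ : ℝ} (h₁ : 1 / 2 < δ) (h₂ : δ < 1) (hρ0 : 0 ≤ ρ) (hρ1 : ρ ≤ 1)
    (h : ρ < rhoS δ) : G δ ρ < 0 := by
  by_contra! hG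
  obtain ⟨z, hz, hz0⟩ := intermediate_value_Icc hρ0 (continuous_G δ).continuousOn
    ⟨(G_zero_neg h₁).le, hG⟩
  have := (eq_rhoS_iff h₁ h₂ z).2 ⟨⟨hz.1, hz.2.trans hρ1⟩, hz0⟩
  linarith [hz.2]

theorem G_pos_of_rhoS_lt {δ ρ : ℝ} (h₁ : 1 / 2 < δ) (h₂ : δ < 1) (hρ0 : 0 ≤ ρ) (hρ1 : ρ ≤ 1)
    (h : rhoS δ < ρ) : 0 < G δ ρ := by
  by_contra! hG
  obtain ⟨z, hz, hz0⟩ := intermediate_value_Icc hρ1 (continuous_G δ).continuousOn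
    ⟨hG, (G_one_pos h₁ h₂).le⟩
  have := (eq_rhoS_iff h₁ h₂ z).2 ⟨⟨hρ0.trans hz.1, hz.2⟩, hz0⟩
  linarith [hz.1]

theorem rhoW_eq {δ : ℝ} (h₁ : 1 / 2 < δ) : rhoW δ = 2 - δ⁻¹ := by
  rw [rhoW, max_eq_right]
  have := inv_anti₀ (by norm_num) h₁.le
  norm_num at this
  linarith

theorem rhoW_lt_one {δ : ℝ} (h₁ : 1 / 2 < δ) (h₂ : δ < 1) : rhoW δ < 1 := by
  rw [rhoW_eq h₁]
  linarith [(one_lt_inv₀ (by linarith)).2 h₂]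

/-- Extends the eventual bounds to all `d ≥ d₀`: the finitely many earlier values are positive. -/
theorem exists_pos_bounds_of_eventually {f : ℕ → ℝ} {d₀ : ℕ} {a b : ℝ} (ha : 0 < a)
    (hpos : ∀ d, d₀ ≤ d → 0 < f d) (h : ∀ᶠ d in atTop, f d ∈ Set.Icc a b) :
    ∃ a' b' : ℝ, 0 < a' ∧ a' ≤ b' ∧ ∀ d, d₀ ≤ d → f d ∈ Set.Icc a' b' := by
  obtain ⟨d₁, hd₁⟩ := eventually_atTop.1 h
  obtain ⟨A, hA⟩ := ((Finset.Ico d₀ d₁).image fun d => (f d)⁻¹).exists_le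
  obtain ⟨B, hB⟩ := ((Finset.Ico d₀ d₁).image f).exists_le
  have hab : a ≤ b := (hd₁ d₁ le_rfl).1.trans (hd₁ d₁ le_rfl).2
  have hm : 0 < max A a⁻¹ := lt_max_of_lt_right (inv_pos.2 ha)
  refine ⟨(max A a⁻¹)⁻¹, max B b, inv_pos.2 hm, ?_, fun d hd => ?_⟩
  · exact ((inv_le_comm₀ hm ha).2 (le_max_right _ _)).trans (hab.trans (le_max_right _ _))
  · rcases lt_or_ge d d₁ with hlt | hge
    · have hmem : d ∈ Finset.Ico d₀ d₁ := Finset.mem_Ico.2 ⟨hd, hlt⟩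
      exact ⟨(inv_le_comm₀ hm (hpos d hd)).2
        ((hA _ (Finset.mem_image_of_mem _ hmem)).trans (le_max_left _ _)),
        (hB _ (Finset.mem_image_of_mem _ hmem)).trans (le_max_left _ _)⟩
    · exact ⟨((inv_le_comm₀ hm ha).2 (le_max_right _ _)).trans (hd₁ d hge).1,
        (hd₁ d hge).2.trans (le_max_right _ _)⟩

/-! ### Asymptotics of the deficit. -/

section Asymptotics

variable {φ : ∀ d : ℕ, Measure (EuclideanSpace ℝ (Fin d))} {δ ρ : ℝ} {N k : ℕ → ℕ} {d₀ : ℕ}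

theorem exists_faceDeficit_eq (hφ : ∀ d, Admissible (φ d)) (hδ₁ : 1 / 2 < δ) (hδ₂ : δ < 1)
    (hρ₁ : 0 < ρ) (hρ₂ : ρ < rhoW δ) (hNk : ∀ d, d₀ ≤ d → 1 ≤ k d ∧ k d < d ∧ d < N d)
    (hN : Tendsto (fun d : ℕ => (d : ℝ) / N d) atTop (𝓝 δ))
    (hk : Tendsto (fun d : ℕ => (k d : ℝ) / d) atTop (𝓝 ρ)) :
    ∃ (h : ℕ → ℝ) (a b : ℝ), 0 < a ∧ a ≤ b ∧
      ∀ d, d₀ ≤ d → h d ∈ Set.Icc a b ∧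
        faceDeficit (φ d) (N d) (k d) =
          1 / (N d : ℝ) * Real.exp ((N d : ℝ) * G ((d : ℝ) / N d) ((k d : ℝ) / d)) * h d := by
  have hδ0 : 0 < δ := by linarith
  have hρ1 : ρ < 1 := hρ₂.trans (rhoW_lt_one hδ₁ hδ₂)
  have hδρ : δ * ρ < 1 := by nlinarith
  have hden : 0 < 2 * δ * (1 - ρ) := mul_pos (by linarith) (by linarith)
  -- The limit of (N-k) / (2(d-k)); `l < 1` is equivalent to ρ < 2 - 1/δ.
  set l := (1 - δ * ρ) / (2 * δ * (1 - ρ)) with hl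
  have hl1 : l < 1 := by
    rw [hl, div_lt_one hden]
    rw [rhoW_eq hδ₁] at hρ₂
    have := mul_lt_mul_of_pos_left hρ₂ hδ0
    rw [mul_sub, mul_inv_cancel₀ hδ0.ne'] at this
    linarith
  have hl2 : 1 / 2 ≤ l := by
    rw [hl, div_le_div_iff₀ (by norm_num) hden]
    linarith
  -- Any value strictly between `l` and 1 would do.
  set q := (l + 1) / 2 with hq
  have hq1 : q < 1 := by rw [hq]; linarith
  have hq2 : 1 / 2 ≤ q := by rw [hq]; linarith
  have hw : Tendsto (fun d : ℕ => weight ((d : ℝ) / N d) ((k d : ℝ) / d)) atTop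
      (𝓝 (weight δ ρ)) := by
    unfold weight
    have s1 : √(2 * δ * (1 - δ)) ≠ 0 :=
      (Real.sqrt_pos.2 (mul_pos (by linarith) (by linarith))).ne'
    have s2 : √(2 * ρ * (1 - ρ)) ≠ 0 :=
      (Real.sqrt_pos.2 (mul_pos (by linarith) (by linarith))).ne'
    have s3 : √δ ≠ 0 := (Real.sqrt_pos.2 hδ0).ne'
    have s4 : 1 - δ * ρ ≠ 0 := by linarith
    exact ((((((hN.const_mul 2).mul (hN.const_sub 1)).sqrt).inv₀ s1).mul
      ((((hk.const_mul 2).mul (hk.const_sub 1)).sqrt).inv₀ s2)).mul (hN.sqrt.inv₀ s3)).mul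
      ((hN.const_sub 1).div ((hN.mul hk).const_sub 1) s4)
  have hw0 : 0 < weight δ ρ := by
    unfold weight
    have s1 : 0 < √(2 * δ * (1 - δ)) := Real.sqrt_pos.2 (mul_pos (by linarith) (by linarith))
    have s2 : 0 < √(2 * ρ * (1 - ρ)) := Real.sqrt_pos.2 (mul_pos (by linarith) (by linarith))
    have s4 : 0 < 1 - δ * ρ := by linarith
    have s5 : 0 < 1 - δ := by linarith
    positivity
  have hqlim : ∀ᶠ d : ℕ in atTop,
      (1 - (d : ℝ) / N d * ((k d : ℝ) / d)) / (2 * ((d : ℝ) / N d) * (1 - (k d : ℝ) / d)) < q :=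
    (((hN.mul hk).const_sub 1).div ((hN.const_mul 2).mul (hk.const_sub 1)) hden.ne').eventually
      (gt_mem_nhds (by rw [← hl, hq]; linarith))
  set f : ℕ → ℝ := fun d => faceDeficit (φ d) (N d) (k d) *
    (N d * Real.exp (-(N d * G ((d : ℝ) / N d) ((k d : ℝ) / d)))) with hf
  have hN0 : ∀ d, d₀ ≤ d → (0 : ℝ) < N d := fun d hd => by
    have := (hNk d hd).2.2
    exact_mod_cast (Nat.zero_le d).trans_lt this
  have hfpos : ∀ d, d₀ ≤ d → 0 < f d := fun d hd => by
    obtain ⟨h1, h2, h3⟩ := hNk d hd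
    have := (leadingTerm_pos h2 h3).trans_le ((hφ d).leadingTerm_le_faceDeficit h1 h2 h3)
    have := hN0 d hd
    rw [hf]
    positivity
  have hfb : ∀ᶠ d in atTop, f d ∈
      Set.Icc (1 / 16 * (weight δ ρ / 2)) (2 / (1 - q) * (4 * (2 * weight δ ρ))) := by
    filter_upwards [eventually_ge_atTop d₀, hqlim, hN.eventually (lt_mem_nhds hδ₁),
      hw.eventually (lt_mem_nhds (by linarith : weight δ ρ / 2 < weight δ ρ)),
      hw.eventually (gt_mem_nhds (by linarith : weight δ ρ < 2 * weight δ ρ))]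
      with d hd hdq hd2 hw1 hw2
    obtain ⟨h1, h2, h3⟩ := hNk d hd
    have hNd := hN0 d hd
    have hkd : (k d : ℝ) < d := by exact_mod_cast h2
    have hk0 : (0 : ℝ) < k d := by exact_mod_cast h1
    have hd0 : (0 : ℝ) < d := hk0.trans hkd
    have hE : 0 < N d * Real.exp (-(N d * G ((d : ℝ) / N d) ((k d : ℝ) / d))) := by positivity
    have hM := leadingTerm_div_mem_Icc h1 h2 h3
    have hN2 : N d ≤ 2 * d := by
      rw [lt_div_iff₀ hNd] at hd2
      have : (N d : ℝ) < 2 * d := by linarith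
      exact_mod_cast this.le
    have hqd : (N d : ℝ) - k d ≤ 2 * q * (d - k d) := by
      have e : (1 - (d : ℝ) / N d * ((k d : ℝ) / d)) /
          (2 * ((d : ℝ) / N d) * (1 - (k d : ℝ) / d)) = (N d - k d) / (2 * (d - k d)) := by
        have : (d : ℝ) - k d ≠ 0 := by linarith
        field_simp
      rw [e, div_lt_iff₀ (by linarith)] at hdq
      linarith
    constructor
    · have := mul_le_mul_of_nonneg_right ((hφ d).leadingTerm_le_faceDeficit h1 h2 h3) hE.le
      refine le_trans ?_ (hM.1.trans this)
      linarith
    · have := mul_le_mul_of_nonneg_right ((hφ d).faceDeficit_le h2 h3 hN2 hq2 hq1 hqd) hE.le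
      refine this.trans ?_
      rw [mul_assoc]
      refine mul_le_mul_of_nonneg_left (hM.2.trans (by linarith)) ?_
      exact div_nonneg (by norm_num) (by linarith)
  obtain ⟨a, b, ha, hab, hb⟩ := exists_pos_bounds_of_eventually (by positivity) hfpos hfb
  refine ⟨f, a, b, ha, hab, fun d hd => ⟨hb d hd, ?_⟩⟩
  have := hN0 d hd
  simp only [hf, Real.exp_neg]
  field_simp

theorem tendsto_natCast_of_lt
    (hNk : ∀ d, d₀ ≤ d → 1 ≤ k d ∧ k d < d ∧ d < N d) :
    Tendsto (fun d => (N d : ℝ)) atTop atTop := by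
  refine tendsto_atTop_mono' _ ?_ tendsto_natCast_atTop_atTop
  filter_upwards [eventually_ge_atTop d₀] with d hd
  exact_mod_cast (hNk d hd).2.2.le

theorem tendsto_G (hN : Tendsto (fun d : ℕ => (d : ℝ) / N d) atTop (𝓝 δ))
    (hk : Tendsto (fun d : ℕ => (k d : ℝ) / d) atTop (𝓝 ρ)) :
    Tendsto (fun d : ℕ => G ((d : ℝ) / N d) ((k d : ℝ) / d)) atTop (𝓝 (G δ ρ)) := by
  unfold G
  have h1 := (Real.binEntropy_continuous.tendsto δ).comp hN
  have h2 := (Real.binEntropy_continuous.tendsto ρ).comp hk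
  exact (h1.add (hN.mul h2)).sub (((hk.mul hN).const_sub 1).mul_const _)

theorem tendsto_faceDeficit_zero (hφ : ∀ d, Admissible (φ d)) (hδ₁ : 1 / 2 < δ) (hδ₂ : δ < 1)
    (hρ₁ : 0 < ρ) (hρ₂ : ρ < rhoW δ) (hNk : ∀ d, d₀ ≤ d → 1 ≤ k d ∧ k d < d ∧ d < N d)
    (hN : Tendsto (fun d : ℕ => (d : ℝ) / N d) atTop (𝓝 δ))
    (hk : Tendsto (fun d : ℕ => (k d : ℝ) / d) atTop (𝓝 ρ)) (h : ρ < rhoS δ) :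
    Tendsto (fun d => faceDeficit (φ d) (N d) (k d)) atTop (𝓝 0) := by
  obtain ⟨f, a, b, ha, hab, hf⟩ := exists_faceDeficit_eq hφ hδ₁ hδ₂ hρ₁ hρ₂ hNk hN hk
  have hG := G_neg_of_lt_rhoS hδ₁ hδ₂ hρ₁.le (hρ₂.trans (rhoW_lt_one hδ₁ hδ₂)).le h
  have hNt := tendsto_natCast_of_lt hNk
  have hlim : Tendsto (fun d : ℕ =>
      Real.exp ((N d : ℝ) * G ((d : ℝ) / N d) ((k d : ℝ) / d)) * b) atTop (𝓝 0) := by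
    have := (Real.tendsto_exp_atBot.comp (hNt.atTop_mul_neg hG (tendsto_G hN hk))).mul_const b
    simpa using this
  refine squeeze_zero' ?_ ?_ hlim
  · filter_upwards [eventually_ge_atTop d₀] with d hd
    obtain ⟨h1, h2⟩ := hf d hd
    rw [h2]
    have := ha.trans_le h1.1
    positivity
  · filter_upwards [eventually_ge_atTop d₀, hNt.eventually_ge_atTop 1] with d hd hd1
    obtain ⟨h1, h2⟩ := hf d hd
    rw [h2]
    have h3 := ha.trans_le h1.1
    have h4 : 1 / (N d : ℝ) ≤ 1 := by rw [div_le_one (by linarith)]; exact hd1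
    have h5 := Real.exp_pos ((N d : ℝ) * G ((d : ℝ) / N d) ((k d : ℝ) / d))
    refine mul_le_mul ?_ h1.2 h3.le h5.le
    nlinarith

theorem tendsto_faceDeficit_atTop (hφ : ∀ d, Admissible (φ d)) (hδ₁ : 1 / 2 < δ) (hδ₂ : δ < 1)
    (hρ₁ : 0 < ρ) (hρ₂ : ρ < rhoW δ) (hNk : ∀ d, d₀ ≤ d → 1 ≤ k d ∧ k d < d ∧ d < N d)
    (hN : Tendsto (fun d : ℕ => (d : ℝ) / N d) atTop (𝓝 δ))
    (hk : Tendsto (fun d : ℕ => (k d : ℝ) / d) atTop (𝓝 ρ)) (h : rhoS δ < ρ) :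
    Tendsto (fun d => faceDeficit (φ d) (N d) (k d)) atTop atTop := by
  obtain ⟨f, a, b, ha, hab, hf⟩ := exists_faceDeficit_eq hφ hδ₁ hδ₂ hρ₁ hρ₂ hNk hN hk
  have hG := G_pos_of_rhoS_lt hδ₁ hδ₂ hρ₁.le (hρ₂.trans (rhoW_lt_one hδ₁ hδ₂)).le h
  have hNt := tendsto_natCast_of_lt hNk
  -- Half the limiting rate is an eventual lower bound for `G` and still beats the factor 1/N.
  set c := G δ ρ / 2 with hc
  have hc0 : 0 < c := by rw [hc]; linarith
  have hlim : Tendsto (fun d : ℕ => (Real.exp (c * N d) / (c * N d) ^ 1) * (c * a)) atTop atTop :=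
    ((Real.tendsto_exp_div_pow_atTop 1).comp (hNt.const_mul_atTop hc0)).atTop_mul_const
      (by positivity)
  refine tendsto_atTop_mono' _ ?_ hlim
  filter_upwards [eventually_ge_atTop d₀, hNt.eventually_ge_atTop 1,
    (tendsto_G hN hk).eventually (lt_mem_nhds (by rw [hc]; linarith : c < G δ ρ))] with d hd hd1 hdG
  obtain ⟨h1, h2⟩ := hf d hd
  have hNd : (0 : ℝ) < N d := by linarith
  rw [h2]
  calc Real.exp (c * N d) / (c * N d) ^ 1 * (c * a)
      = 1 / (N d : ℝ) * Real.exp (N d * c) * a := by rw [mul_comm (N d : ℝ) c]; field_simp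
    _ ≤ _ := by gcongr; exact h1.1

/-! ### Sequences for the critical case. -/

/-- The number `⌊t d⌋`, truncated to lie between `1` and `d - 1`. -/
noncomputable def faceDim (t : ℝ) (d : ℕ) : ℕ := max 1 (min (d - 1) ⌊t * d⌋₊)

theorem one_le_faceDim (t : ℝ) (d : ℕ) : 1 ≤ faceDim t d := le_max_left _ _

theorem faceDim_lt (t : ℝ) {d : ℕ} (hd : 2 ≤ d) : faceDim t d < d := by
  unfold faceDim
  omega

/-- As 0 < ρ < 1, the truncation is eventually inactive. -/
theorem tendsto_faceDim_div {t : ℕ → ℝ} (ht : Tendsto t atTop (𝓝 ρ)) (hρ₁ : 0 < ρ)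
    (hρ₂ : ρ < 1) : Tendsto (fun d : ℕ => (faceDim (t d) d : ℝ) / d) atTop (𝓝 ρ) := by
  have h1 : ∀ᶠ d : ℕ in atTop, 1 ≤ t d * d :=
    (ht.pos_mul_atTop hρ₁ tendsto_natCast_atTop_atTop).eventually_ge_atTop 1
  have h2 : ∀ᶠ d : ℕ in atTop, 1 ≤ (1 - t d) * d :=
    ((ht.const_sub 1).pos_mul_atTop (by linarith)
      tendsto_natCast_atTop_atTop).eventually_ge_atTop 1
  have h3 : ∀ᶠ d : ℕ in atTop, faceDim (t d) d = ⌊t d * d⌋₊ := by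
    filter_upwards [h1, h2] with d hd1 hd2
    have a1 : 1 ≤ ⌊t d * d⌋₊ := Nat.le_floor (by simpa using hd1)
    have a2 : ⌊t d * d⌋₊ + 1 ≤ d := by
      have := Nat.floor_le (by linarith : 0 ≤ t d * d)
      have : ((⌊t d * d⌋₊ + 1 : ℕ) : ℝ) ≤ d := by push_cast; linarith
      exact_mod_cast this
    unfold faceDim
    omega
  have hlow : Tendsto (fun d : ℕ => t d - 1 / (d : ℝ)) atTop (𝓝 ρ) := by
    simpa using ht.sub tendsto_one_div_atTop_nhds_zero_nat
  refine tendsto_of_tendsto_of_tendsto_of_le_of_le' hlow ht ?_ ?_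
  · filter_upwards [h3, eventually_gt_atTop 0] with d hd hd0
    have hd0' : (0 : ℝ) < d := by exact_mod_cast hd0
    rw [hd, le_div_iff₀ hd0', sub_mul, one_div_mul_cancel hd0'.ne']
    linarith [Nat.lt_floor_add_one (t d * d)]
  · filter_upwards [h3, h1, eventually_gt_atTop 0] with d hd hd1 hd0
    have hd0' : (0 : ℝ) < d := by exact_mod_cast hd0
    rw [hd, div_le_iff₀ hd0']
    exact Nat.floor_le (by linarith)

theorem lt_ceil_div (hδ₀ : 0 < δ) (hδ₂ : δ < 1) {d : ℕ} (hd : 0 < d) : d < ⌈(d : ℝ) / δ⌉₊ := by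
  have hd0 : (0 : ℝ) < d := by exact_mod_cast hd
  rw [Nat.lt_ceil, lt_div_iff₀ hδ₀]
  nlinarith

theorem tendsto_div_ceil (hδ₀ : 0 < δ) :
    Tendsto (fun d : ℕ => (d : ℝ) / ⌈(d : ℝ) / δ⌉₊) atTop (𝓝 δ) := by
  have h := (tendsto_nat_ceil_mul_div_atTop (R := ℝ) (inv_nonneg.2 hδ₀.le)).comp
    (tendsto_natCast_atTop_atTop (R := ℝ))
  have h' := h.inv₀ (inv_ne_zero hδ₀.ne')
  rw [inv_inv] at h'
  refine h'.congr fun d => ?_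
  simp [div_eq_inv_mul]

/-- A diagonal argument: for each fixed `n` the slope ρ ± `e n` is off the critical value, so the
limits already proved apply; one dimension is picked per `n`, far enough out. -/
theorem exists_critical_sequences (hφ : ∀ d, Admissible (φ d)) (hδ₁ : 1 / 2 < δ) (hδ₂ : δ < 1)
    (hρ₁ : 0 < ρ) (hρ₂ : ρ < rhoW δ) (hρ : ρ = rhoS δ) :
    ∃ N k : ℕ → ℕ,
      (∀ d, 2 ≤ d → 1 ≤ k d ∧ k d < d ∧ d < N d) ∧
      Tendsto (fun d : ℕ => (d : ℝ) / N d) atTop (𝓝 δ) ∧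
      Tendsto (fun d : ℕ => (k d : ℝ) / d) atTop (𝓝 ρ) ∧
      liminf (fun d => ((faceDeficit (φ d) (N d) (k d) : ℝ) : EReal)) atTop = 0 ∧
      limsup (fun d => ((faceDeficit (φ d) (N d) (k d) : ℝ) : EReal)) atTop = ⊤ := by
  have hδ0 : 0 < δ := by linarith
  have hW := rhoW_lt_one hδ₁ hδ₂
  -- Keeps all slopes ρ ± `e n` inside `(0, rhoW δ)`.
  obtain ⟨η, hη, hη₁, hη₂⟩ : ∃ η, 0 < η ∧ η < ρ ∧ η < rhoW δ - ρ := by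
    obtain ⟨η, h0, h1⟩ := exists_between (lt_min hρ₁ (sub_pos.2 hρ₂))
    exact ⟨η, h0, h1.trans_le (min_le_left _ _), h1.trans_le (min_le_right _ _)⟩
  set e : ℕ → ℝ := fun n => η * (1 / ((n : ℝ) + 1)) with he
  have he0 : ∀ n, 0 < e n := fun n => by rw [he]; positivity
  have heη : ∀ n, e n ≤ η := fun n => by
    have : 1 / ((n : ℝ) + 1) ≤ 1 := by
      rw [div_le_one (by positivity)]
      linarith [(Nat.cast_nonneg n : (0 : ℝ) ≤ n)]
    exact mul_le_of_le_one_right hη.le this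
  have helim : Tendsto e atTop (𝓝 0) := by
    simpa [he] using (tendsto_one_div_add_atTop_nhds_zero_nat (𝕜 := ℝ)).const_mul η
  set s : ℕ → ℝ := fun n => if Even n then ρ + e n else ρ - e n with hs
  set N : ℕ → ℕ := fun d => ⌈(d : ℝ) / δ⌉₊ with hN
  have hNlim : Tendsto (fun d : ℕ => (d : ℝ) / N d) atTop (𝓝 δ) := tendsto_div_ceil hδ0
  have hadm : ∀ (t : ℕ → ℝ) d, 2 ≤ d → 1 ≤ faceDim (t d) d ∧ faceDim (t d) d < d ∧ d < N d :=
    fun t d hd => ⟨one_le_faceDim _ _, faceDim_lt _ hd, lt_ceil_div hδ0 hδ₂ (by omega)⟩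
  have hP : ∀ n : ℕ, ∀ᶠ d in atTop,
      (Even n → (n : ℝ) ≤ faceDeficit (φ d) (N d) (faceDim (s n) d)) ∧
      (¬ Even n → faceDeficit (φ d) (N d) (faceDim (s n) d) ≤ 1 / ((n : ℝ) + 1)) := by
    intro n
    have h1 := he0 n
    have h2 := heη n
    have hs1 : 0 < s n := by rw [hs]; dsimp only; split_ifs <;> linarith
    have hs2 : s n < rhoW δ := by rw [hs]; dsimp only; split_ifs <;> linarith
    have hlim : Tendsto (fun d : ℕ => (faceDim (s n) d : ℝ) / d) atTop (𝓝 (s n)) :=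
      tendsto_faceDim_div tendsto_const_nhds hs1 (hs2.trans hW)
    by_cases hn : Even n
    · have hgt : rhoS δ < s n := by rw [hs]; simp only [hn, if_true]; linarith
      filter_upwards [(tendsto_faceDeficit_atTop hφ hδ₁ hδ₂ hs1 hs2 (hadm fun _ => s n) hNlim hlim
        hgt).eventually_ge_atTop (n : ℝ)] with d hd
      exact ⟨fun _ => hd, fun h => (h hn).elim⟩
    · have hlt : s n < rhoS δ := by rw [hs]; simp only [hn, if_false]; linarith
      filter_upwards [(tendsto_faceDeficit_zero hφ hδ₁ hδ₂ hs1 hs2 (hadm fun _ => s n) hNlim hlim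
        hlt).eventually (gt_mem_nhds (by positivity : (0 : ℝ) < 1 / ((n : ℝ) + 1)))] with d hd
      exact ⟨fun h => (hn h).elim, fun _ => hd.le⟩
  obtain ⟨ψ, hψ, hψP⟩ := extraction_forall_of_eventually hP
  -- Slope `s n` at dimension `ψ n` and ρ elsewhere, so the slopes still converge to ρ.
  set t : ℕ → ℝ := Function.extend ψ s fun _ => ρ with ht
  have htψ : ∀ n, t (ψ n) = s n := fun n => hψ.injective.extend_apply _ _ _
  have htlim : Tendsto t atTop (𝓝 ρ) := by
    rw [Metric.tendsto_atTop]
    intro r hr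
    obtain ⟨n₀, hn₀⟩ := eventually_atTop.1 (helim.eventually (gt_mem_nhds hr))
    refine ⟨ψ n₀, fun d hd => ?_⟩
    by_cases hex : ∃ n, ψ n = d
    · obtain ⟨n, rfl⟩ := hex
      have h1 := hn₀ n (hψ.le_iff_le.1 hd)
      have h2 := he0 n
      rw [htψ, Real.dist_eq, abs_lt, hs]
      dsimp only
      split_ifs <;> constructor <;> linarith
    · rw [ht, Function.extend_apply' _ _ _ hex, dist_self]
      exact hr
  have hklim := tendsto_faceDim_div htlim hρ₁ (hρ₂.trans hW)
  set D : ℕ → ℝ := fun d => faceDeficit (φ d) (N d) (faceDim (t d) d) with hD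
  have hD0 : ∀ᶠ d in atTop, 0 ≤ D d := by
    filter_upwards [eventually_ge_atTop 2] with d hd
    obtain ⟨h1, h2, h3⟩ := hadm t d hd
    exact (leadingTerm_pos h2 h3).le.trans ((hφ d).leadingTerm_le_faceDeficit h1 h2 h3)
  have hψt : Tendsto ψ atTop atTop := hψ.tendsto_atTop
  have hodd : Tendsto (fun n : ℕ => ψ (2 * n + 1)) atTop atTop :=
    hψt.comp (tendsto_atTop_mono (fun n => by simp only [id]; omega) tendsto_id)
  have heven : Tendsto (fun n : ℕ => ψ (2 * n)) atTop atTop :=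
    hψt.comp (tendsto_atTop_mono (fun n => by simp only [id]; omega) tendsto_id)
  refine ⟨N, fun d => faceDim (t d) d, hadm t, hNlim, hklim, ?_, ?_⟩
  · apply le_antisymm
    · have hlim : Tendsto (fun n : ℕ => D (ψ (2 * n + 1))) atTop (𝓝 0) := by
        refine squeeze_zero' (hodd.eventually hD0) (Eventually.of_forall fun n => ?_)
          (tendsto_one_div_add_atTop_nhds_zero_nat (𝕜 := ℝ))
        have h := (hψP (2 * n + 1)).2 (by simp)
        rw [← htψ] at h
        refine h.trans ?_
        push_cast
        gcongr
        linarith [(Nat.cast_nonneg n : (0 : ℝ) ≤ n)]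
      have hlim' := ((continuous_coe_real_ereal.tendsto 0).comp hlim).liminf_eq
      rw [EReal.coe_zero] at hlim'
      rw [← hlim']
      exact liminf_le_liminf_of_le (u := fun d => ((D d : ℝ) : EReal)) hodd
    · refine le_liminf_of_le (by isBoundedDefault) ?_
      filter_upwards [hD0] with d hd
      exact_mod_cast hd
  · rw [eq_top_iff]
    have hlim : Tendsto (fun n : ℕ => D (ψ (2 * n))) atTop atTop := by
      refine tendsto_atTop_mono (fun n => ?_) (tendsto_natCast_atTop_atTop (R := ℝ))
      have h := (hψP (2 * n)).1 (by simp)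
      rw [← htψ] at h
      refine le_trans ?_ h
      push_cast
      linarith [(Nat.cast_nonneg n : (0 : ℝ) ≤ n)]
    have hlim' := (EReal.tendsto_coe_nhds_top_iff.2 hlim).limsup_eq
    rw [← hlim']
    exact limsup_le_limsup_of_le (u := fun d => ((D d : ℝ) : EReal)) heven

end Asymptotics

end CoverEfron

theorem theoremT6p2
    (φ : ∀ d : ℕ, Measure (EuclideanSpace ℝ (Fin d)))
    (hφ : ∀ d, CoverEfron.Admissible (φ d))
    (δ ρ : ℝ) (hδ₁ : 1 / 2 < δ) (hδ₂ : δ < 1) (hρ₁ : 0 < ρ) (hρ₂ : ρ < CoverEfron.rhoW δ) :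
    (∀ (N k : ℕ → ℕ) (d₀ : ℕ),
      (∀ d, d₀ ≤ d → 1 ≤ k d ∧ k d < d ∧ d < N d) →
      Tendsto (fun d : ℕ => (d : ℝ) / N d) atTop (𝓝 δ) →
      Tendsto (fun d : ℕ => (k d : ℝ) / d) atTop (𝓝 ρ) →
      (∃ (h : ℕ → ℝ) (a b : ℝ), 0 < a ∧ a ≤ b ∧
        ∀ d, d₀ ≤ d → h d ∈ Set.Icc a b ∧
          CoverEfron.faceDeficit (φ d) (N d) (k d) =
            1 / (N d : ℝ) *
              Real.exp ((N d : ℝ) * CoverEfron.G ((d : ℝ) / N d) ((k d : ℝ) / d)) * h d) ∧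
      (ρ < CoverEfron.rhoS δ →
        Tendsto (fun d => CoverEfron.faceDeficit (φ d) (N d) (k d)) atTop (𝓝 0)) ∧
      (CoverEfron.rhoS δ < ρ →
        Tendsto (fun d => CoverEfron.faceDeficit (φ d) (N d) (k d)) atTop atTop)) ∧
    (ρ = CoverEfron.rhoS δ →
      ∃ N k : ℕ → ℕ,
        (∀ d, 2 ≤ d → 1 ≤ k d ∧ k d < d ∧ d < N d) ∧
        Tendsto (fun d : ℕ => (d : ℝ) / N d) atTop (𝓝 δ) ∧
        Tendsto (fun d : ℕ => (k d : ℝ) / d) atTop (𝓝 ρ) ∧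
        liminf (fun d => ((CoverEfron.faceDeficit (φ d) (N d) (k d) : ℝ) : EReal)) atTop = 0 ∧
        limsup (fun d => ((CoverEfron.faceDeficit (φ d) (N d) (k d) : ℝ) : EReal)) atTop = ⊤) := by
  exact ⟨fun _ _ _ hNk hN hk =>
    ⟨CoverEfron.exists_faceDeficit_eq hφ hδ₁ hδ₂ hρ₁ hρ₂ hNk hN hk,
      CoverEfron.tendsto_faceDeficit_zero hφ hδ₁ hδ₂ hρ₁ hρ₂ hNk hN hk,
      CoverEfron.tendsto_faceDeficit_atTop hφ hδ₁ hδ₂ hρ₁ hρ₂ hNk hN hk⟩,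
    CoverEfron.exists_critical_sequences hφ hδ₁ hδ₂ hρ₁ hρ₂⟩
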